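/- Let $n\ge 1$ and $\lambda>0$. Let $A\in\mathbb{R}^{n\times n}$ be the matrix with ones on the first superdiagonal and zeros elsewhere, $B=(0,\dots,0,1)^\top\in\mathbb{R}^n$, $G_{\mathbf d}=\mathrm{diag}\{n,n-1,\dots,1\}$ and $\mathbf d(s)=e^{sG_{\mathbf d}}$ for $s\in\mathbb{R}$. Put $h_i=-e_1^\top(A+\lambda I)^{i-1}$ for $i=1,\dots,n$, $K=-e_1^\top(A+\lambda I)^n$, $\Omega=\{x\in\mathbb{R}^n: h_ix\ge 0,\ i=1,\dots,n\}$ and $\Sigma_-=\{x\in\mathbb{R}^n: x_1\le 0\}$. For a symmetric matrix $P\in\mathbb{R}^{n\times n}$ let $Z=P(A+BK)+(A+BK)^\top P$ and $Q=PG_{\mathbf d}+G_{\mathbf d}P$. (i) There is a symmetric $P\in\mathbb{R}^{n\times n}$ with $$Z\prec 0,\qquad Q\succ 0,\qquad P\succ 0. \tag{1}$$ Now let $P$ be any symmetric solution of (1). Then $\rho:=-\lambda_{\max}\big(Q^{-1/2}ZQ^{-1/2}\big)>0$. Let $T>0$, $r>0$ and $\tilde s\ge\ln\max\{1/(\rho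 T),1\}$ be arbitrary, and put $\|x\|=\sqrt{x^\top\mathbf d(\tilde s)P\mathbf d(\tilde s)x}$. For every $x\ne 0$ there is exactly one $s_x\in\mathbb{R}$ with $\|\mathbf d(-s_x)x\|=1$; let $\|x\|_{\mathbf d}=e^{s_x}$ for $x\neq 0$, and $\|0\|_{\mathbf d}=0$. Let $$u_{\rm h}(x)=K\,\mathbf d(\tilde s)\,\mathbf d\big(-\ln\|x/r\|_{\mathbf d}\big)x\quad (x\ne 0),\qquad u_{\rm h}(0)=0,$$ $$\Omega_r=\{0\}\cup\big\{x\neq 0: h_i\,\mathbf d(\tilde s)\,\mathbf d(-\ln\|x/r\|_{\mathbf d})x\ge 0,\ i=1,\dots,n\big\},$$ and consider the closed-loop system $\dot x=Ax+Bu_{\rm h}(x)$, whose right-hand side is discontinuous at $0$ and whose solutions on $[0,\infty)$ are understood in the sense of Filippov. (ii) From every initial state there is a solution on $[0,\infty)$, and the system is globally uniformly finite-time stable: the origin is Lyapunov stable, and there is a locally bounded function $\tau:\mathbb{R}^n\to[0,\infty)$ such that every solution satisfies $x(t)=0$ for all $t\ge\tau(x(0))$. Moreover, every solution with $\|x(0)\|\le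 r$ satisfies $x(t)=0$ for all $t\ge T$. (iii) The homogeneous cone $\Omega_r$ is positively invariant: every solution with $x(0)\in\Omega_r$ satisfies $x(t)\in\Omega_r$ for all $t\ge 0$. Moreover $\Omega_r\subset\Sigma_-$ and $\Omega\subset\Sigma_-$, and every $x_0\in\Omega$ with $\|x_0/r\|_{\mathbf d}\le e^{\tilde s}$ belongs to $\Omega_r$. -/

import Mathlib

noncomputable section

namespace HomControl

open Matrix MeasureTheory
open scoped Matrix MatrixOrder

/-! ### The chain of integrators, its dilation, and the linear nonovershooting gain

The state space is `Fin n → ℝ`; the index `i : Fin n` stands for the coordinate number `i + 1`. -/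

/-- The matrix `A` of the chain of integrators: ones on the first superdiagonal. -/
def chainMatrix (n : ℕ) : Matrix (Fin n) (Fin n) ℝ :=
  Matrix.of fun i j => if (i : ℕ) + 1 = (j : ℕ) then 1 else 0

/-- The input column `B = (0, …, 0, 1)ᵀ`. -/
def inputVec (n : ℕ) : Fin n → ℝ := fun i => if (i : ℕ) + 1 = n then 1 else 0

/-- The row `-e₁ᵀ (A + λ I)ᵏ`. -/
def chainRow (n : ℕ) [NeZero n] (lam : ℝ) (k : ℕ) : Fin n → ℝ :=
  -(Pi.single (0 : Fin n) (1 : ℝ) ᵥ* (chainMatrix n + lam • (1 : Matrix (Fin n) (Fin n) ℝ)) ^ k)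

/-- The rows `h₁, …, hₙ` of the barrier functions, `hᵢ = -e₁ᵀ (A + λ I)ⁱ⁻¹`. -/
def barrierRow (n : ℕ) [NeZero n] (lam : ℝ) (i : Fin n) : Fin n → ℝ := chainRow n lam i

/-- The linear gain `K = -e₁ᵀ (A + λ I)ⁿ`. -/
def gain (n : ℕ) [NeZero n] (lam : ℝ) : Fin n → ℝ := chainRow n lam n

/-- The closed-loop matrix `A + B K` of the linear feedback. -/
def closedLoopMatrix (n : ℕ) [NeZero n] (lam : ℝ) : Matrix (Fin n) (Fin n) ℝ :=
  chainMatrix n + vecMulVec (inputVec n) (gain n lam)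

/-- The generator `G_d = diag (n, n - 1, …, 1)` of the dilation. -/
def dilGen (n : ℕ) : Matrix (Fin n) (Fin n) ℝ :=
  Matrix.diagonal fun i => (n : ℝ) - (i : ℕ)

/-- The dilation `d(s) = exp (s G_d)`. -/
def dil (n : ℕ) (s : ℝ) : Matrix (Fin n) (Fin n) ℝ := NormedSpace.exp (s • dilGen n)

/-! ### Linear matrix inequalities and the decay rate -/

/-- `Z = P (A + B K) + (A + B K)ᵀ P`. -/
def lmiZ (n : ℕ) [NeZero n] (lam : ℝ) (P : Matrix (Fin n) (Fin n) ℝ) :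
    Matrix (Fin n) (Fin n) ℝ :=
  P * closedLoopMatrix n lam + (closedLoopMatrix n lam)ᵀ * P

/-- `Q = P G_d + G_d P`. -/
def lmiQ (n : ℕ) (P : Matrix (Fin n) (Fin n) ℝ) : Matrix (Fin n) (Fin n) ℝ :=
  P * dilGen n + dilGen n * P

/-- `P` is a (symmetric) solution of the linear matrix inequalities
`Z ≺ 0`, `Q ≻ 0`, `P ≻ 0`. -/
def IsLMISolution (n : ℕ) [NeZero n] (lam : ℝ) (P : Matrix (Fin n) (Fin n) ℝ) : Prop :=
  (-(lmiZ n lam P)).PosDef ∧ (lmiQ n P).PosDef ∧ P.PosDef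

/-- The largest (real) eigenvalue of a symmetric matrix. -/
def lambdaMax {n : ℕ} (M : Matrix (Fin n) (Fin n) ℝ) : ℝ := sSup (spectrum ℝ M)

/-- `ρ = -λ_max (Q^{-1/2} Z Q^{-1/2})`, with `Q^{1/2}` the positive semidefinite square root. -/
def decayRate (n : ℕ) [NeZero n] (lam : ℝ) (P : Matrix (Fin n) (Fin n) ℝ) : ℝ :=
  -lambdaMax ((CFC.sqrt (lmiQ n P))⁻¹ * lmiZ n lam P * (CFC.sqrt (lmiQ n P))⁻¹)

/-! ### The canonical homogeneous norm -/

/-- The weighted Euclidean norm `√(xᵀ P x)`. -/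
def weightedNorm {n : ℕ} (P : Matrix (Fin n) (Fin n) ℝ) (x : Fin n → ℝ) : ℝ :=
  Real.sqrt (x ⬝ᵥ (P *ᵥ x))

open Classical in
/-- The canonical homogeneous norm induced by `weightedNorm P`: it vanishes at `0`, and for
`x ≠ 0` it is `exp σ` where `σ` is determined by `‖d(-σ) x‖ = 1`. -/
def homNorm {n : ℕ} (P : Matrix (Fin n) (Fin n) ℝ) (x : Fin n → ℝ) : ℝ :=
  if x = 0 then 0
  else Real.exp (Classical.epsilon fun σ : ℝ => weightedNorm P (dil n (-σ) *ᵥ x) = 1)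

/-- The matrix `d(s) P d(s)` of the weighted norm used by the homogeneous controller. -/
def scaledWeight {n : ℕ} (P : Matrix (Fin n) (Fin n) ℝ) (s : ℝ) : Matrix (Fin n) (Fin n) ℝ :=
  dil n s * P * dil n s

/-- The map `x ↦ d(-ln ‖x / r‖_d) x`, where `‖·‖_d` is induced by the norm with matrix
`d(s) P d(s)`. -/
def homProj {n : ℕ} (P : Matrix (Fin n) (Fin n) ℝ) (s r : ℝ) (x : Fin n → ℝ) : Fin n → ℝ :=
  dil n (-Real.log (homNorm (scaledWeight P s) (r⁻¹ • x))) *ᵥ x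

/-! ### The homogeneous feedback, and the linear and homogeneous cones -/

/-- The homogeneous feedback `u_h(x) = K d(s) d(-ln ‖x / r‖_d) x`. -/
def homFeedback (n : ℕ) [NeZero n] (lam : ℝ) (P : Matrix (Fin n) (Fin n) ℝ) (s r : ℝ)
    (x : Fin n → ℝ) : ℝ :=
  (gain n lam ᵥ* dil n s) ⬝ᵥ homProj P s r x

/-- The right-hand side `A x + B u_h(x)` of the closed-loop system. -/
def closedLoop (n : ℕ) [NeZero n] (lam : ℝ) (P : Matrix (Fin n) (Fin n) ℝ) (s r : ℝ)
    (x : Fin n → ℝ) : Fin n → ℝ :=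
  chainMatrix n *ᵥ x + homFeedback n lam P s r x • inputVec n

/-- The linear cone `Ω = {x | hᵢ x ≥ 0 for all i}`. -/
def linCone (n : ℕ) [NeZero n] (lam : ℝ) : Set (Fin n → ℝ) :=
  {x | ∀ i, 0 ≤ barrierRow n lam i ⬝ᵥ x}

/-- The homogeneous cone `Ω_r = {x | hᵢ d(s) d(-ln ‖x / r‖_d) x ≥ 0 for all i}`. -/
def homCone (n : ℕ) [NeZero n] (lam : ℝ) (P : Matrix (Fin n) (Fin n) ℝ) (s r : ℝ) :
    Set (Fin n → ℝ) :=
  {x | ∀ i, 0 ≤ (barrierRow n lam i ᵥ* dil n s) ⬝ᵥ homProj P s r x}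

/-- The half-space `{x | x₁ ≤ 0}`. -/
def safeHalfSpace (n : ℕ) [NeZero n] : Set (Fin n → ℝ) := {x | x 0 ≤ 0}

/-! ### Differential equations with discontinuous right-hand side

All notions below are independent of the choice of norm on the finite-dimensional state space. -/

/-- The Filippov regularization of a vector field `f`:
`F(x) = ⋂_{δ > 0} ⋂_{N null} closure (conv f(ball(x, δ) \ N))`. -/
def filippovMap {n : ℕ} (f : (Fin n → ℝ) → (Fin n → ℝ)) (x : Fin n → ℝ) : Set (Fin n → ℝ) :=
  {v | ∀ δ : ℝ, 0 < δ → ∀ N : Set (Fin n → ℝ), volume N = 0 →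
    v ∈ closure (convexHull ℝ (f '' (Metric.ball x δ \ N)))}

/-- `x` is, on `[0, ∞)`, a Filippov solution of `ẋ = f(x)`: it is locally absolutely continuous
and `ẋ(t) ∈ F(x(t))` for almost every `t > 0`. -/
def IsFilippovSolution {n : ℕ} (f : (Fin n → ℝ) → (Fin n → ℝ)) (x : ℝ → Fin n → ℝ) : Prop :=
  (∀ b : ℝ, 0 ≤ b → AbsolutelyContinuousOnInterval x 0 b) ∧
  ∀ᵐ t : ℝ, 0 < t → ∃ v ∈ filippovMap f (x t), HasDerivAt x v t

/-- From every initial state there is a solution on the whole of `[0, ∞)`. -/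
def HasGlobalSolutions {n : ℕ} (f : (Fin n → ℝ) → (Fin n → ℝ)) : Prop :=
  ∀ x₀ : Fin n → ℝ, ∃ x : ℝ → Fin n → ℝ, IsFilippovSolution f x ∧ x 0 = x₀

/-- Lyapunov stability of the origin. -/
def IsLyapunovStable {n : ℕ} (f : (Fin n → ℝ) → (Fin n → ℝ)) : Prop :=
  ∀ ε : ℝ, 0 < ε → ∃ δ : ℝ, 0 < δ ∧ ∀ x : ℝ → Fin n → ℝ, IsFilippovSolution f x →
    ‖x 0‖ < δ → ∀ t : ℝ, 0 ≤ t → ‖x t‖ < ε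

/-- Global uniform finite-time stability: Lyapunov stability, and a locally bounded function
bounding the settling time of every solution. -/
def IsFiniteTimeStable {n : ℕ} (f : (Fin n → ℝ) → (Fin n → ℝ)) : Prop :=
  IsLyapunovStable f ∧
  ∃ τ : (Fin n → ℝ) → ℝ, (∀ y, 0 ≤ τ y) ∧
    (∀ y, ∃ C : ℝ, ∀ᶠ z in nhds y, τ z ≤ C) ∧
    ∀ x : ℝ → Fin n → ℝ, IsFilippovSolution f x → ∀ t : ℝ, τ (x 0) ≤ t → x t = 0

/-- Positive invariance of a set. -/
def IsPositivelyInvariant {n : ℕ} (f : (Fin n → ℝ) → (Fin n → ℝ)) (S : Set (Fin n → ℝ)) : Prop :=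
  ∀ x : ℝ → Fin n → ℝ, IsFilippovSolution f x → x 0 ∈ S → ∀ t : ℝ, 0 ≤ t → x t ∈ S

end HomControl

end

/-!
The dilation conjugates the closed loop to a flow on one ellipsoid. For `x ≠ 0` let `level x` be
the unique `τ` with `(d(τ) x)ᵀ P (d(τ) x) = r²`; it exists because `Q ≻ 0` makes `τ ↦ ‖d(τ) x‖_P`
strictly increasing. Then `‖x / r‖_d = e^{s - level x}`, so that the feedback is `K z` with
`z = d(level x) x`, whatever `s` is, and since `d(τ) A = e^τ A d(τ)` and `d(τ) B = e^τ B`, a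
solution satisfies, while it does not vanish, `(level x)' = e^{level x} κ(z)` and
`z' = e^{level x} ((A + B K) z + κ(z) G_d z)`, where `κ(z) = -(zᵀ Z z) / (zᵀ Q z) ≥ ρ`
(`hasDerivAt_level_comp`, `hasDerivAt_sphereProj_comp`).

* Stability. The gauge `e^{-level x}` decreases at rate `κ(z) ≥ ρ` until it reaches `0`, and then
  stays there (`gauge_le_max`). This gives Lyapunov stability and the settling times. Away from
  the origin the right-hand side is continuous, so a Filippov solution is classical there
  (`IsFilippovSolution.hasDerivAt`).
* Cones. In the coordinates `hᵢ z` the matrix `A + B K` becomes `N - λ I`, with `N` the upper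
  shift, and `G_d` becomes lower bidiagonal with entries `(i - 1) λ ≥ 0` below the diagonal. Both
  are Metzler, so the nonnegative orthant is invariant (`nonneg_of_hasDerivAt_metzler`), both
  along the closed loop and along the dilation itself.
* Feasibility. In the same coordinates `P⁻¹` is taken to be the Gram matrix of the functions
  `t^a / a!`, `a < n`, in `L²(e^{-t/m} dt)`, which is a scaled Pascal matrix. Pascal's rule is the
  Lyapunov equation that gives `Z ≺ 0` as soon as `1 / m < 2 λ` (`gram_lyapunov`). At
  `1 / m = 2 λ` the symmetric part of the transformed `G_d` times this matrix is a sum of two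
  positive definite Pascal matrices (`pascal_gen_identity`), and positive definiteness survives a
  small change of `m`.
* Existence. With the level as time, `z` follows the smooth field `G_d z + κ(z)⁻¹ (A + B K) z` on
  the compact ellipsoid, hence for all times (`exists_sphere_integralCurve`). Physical time is
  recovered by integrating with respect to the gauge, which runs backwards at a speed between two
  positive bounds (`exists_clock`). At the origin `0` is an admissible velocity because the
  feedback is odd.
-/

noncomputable section

namespace HomControl

open Matrix MeasureTheory Filter Topology
open scoped Matrix MatrixOrder

/-! ### The dilation and the barrier rows -/

theorem chainMatrix_mulVec_apply {n : ℕ} (v : Fin n → ℝ) (i : Fin n) :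
    (chainMatrix n *ᵥ v) i = if h : (i : ℕ) + 1 < n then v ⟨i + 1, h⟩ else 0 := by
  simp only [mulVec, dotProduct, chainMatrix, of_apply]
  split_ifs with h
  · rw [Finset.sum_eq_single ⟨i + 1, h⟩]
    · simp
    · intro j _ hj
      rw [if_neg, zero_mul]
      intro h'
      exact hj (Fin.ext h'.symm)
    · simp
  · refine Finset.sum_eq_zero fun j _ => ?_
    rw [if_neg, zero_mul]
    have := j.2
    omega

theorem vecMul_chainMatrix_apply {n : ℕ} (v : Fin n → ℝ) (j : Fin n) :
    (v ᵥ* chainMatrix n) j = if h : (j : ℕ) = 0 then 0 else v ⟨j - 1, by omega⟩ := by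
  simp only [vecMul, dotProduct, chainMatrix, of_apply]
  split_ifs with h
  · refine Finset.sum_eq_zero fun i _ => ?_
    rw [if_neg (by omega), mul_zero]
  · rw [Finset.sum_eq_single ⟨j - 1, by omega⟩]
    · rw [if_pos (by simp only; omega), mul_one]
    · intro i _ hi
      rw [if_neg, mul_zero]
      intro h'
      exact hi (Fin.ext (by simp only; omega))
    · simp

theorem dilGen_mulVec_apply {n : ℕ} (x : Fin n → ℝ) (i : Fin n) :
    (dilGen n *ᵥ x) i = ((n : ℝ) - (i : ℕ)) * x i := by
  simp [dilGen, mulVec_diagonal]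

theorem dil_eq_diagonal (n : ℕ) (s : ℝ) :
    dil n s = Matrix.diagonal fun i : Fin n => Real.exp (s * ((n : ℝ) - (i : ℕ))) := by
  rw [dil, dilGen, ← Matrix.diagonal_smul, Matrix.exp_diagonal]
  congr 1
  ext i
  rw [Pi.coe_exp, Real.exp_eq_exp_ℝ]
  simp

theorem dil_mulVec_apply {n : ℕ} (s : ℝ) (x : Fin n → ℝ) (i : Fin n) :
    (dil n s *ᵥ x) i = Real.exp (s * ((n : ℝ) - (i : ℕ))) * x i := by
  rw [dil_eq_diagonal, mulVec_diagonal]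

theorem dil_zero (n : ℕ) : dil n 0 = 1 := by
  rw [dil_eq_diagonal]; simp

theorem dil_mul_dil (n : ℕ) (s t : ℝ) : dil n s * dil n t = dil n (s + t) := by
  simp only [dil_eq_diagonal, diagonal_mul_diagonal, ← Real.exp_add, add_mul]

theorem dil_transpose (n : ℕ) (s : ℝ) : (dil n s)ᵀ = dil n s := by
  rw [dil_eq_diagonal, diagonal_transpose]

theorem dil_mulVec_dil_mulVec {n : ℕ} (s t : ℝ) (x : Fin n → ℝ) :
    dil n s *ᵥ (dil n t *ᵥ x) = dil n (s + t) *ᵥ x := by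
  rw [mulVec_mulVec, dil_mul_dil]

theorem dil_mulVec_eq_zero_iff {n : ℕ} {s : ℝ} {x : Fin n → ℝ} :
    dil n s *ᵥ x = 0 ↔ x = 0 := by
  simp only [funext_iff, dil_mulVec_apply, Pi.zero_apply, mul_eq_zero, Real.exp_ne_zero, false_or]

/-- The chain of integrators is homogeneous of degree `-1` with respect to the dilation. -/
theorem chainMatrix_mulVec_dil {n : ℕ} (s : ℝ) (x : Fin n → ℝ) :
    chainMatrix n *ᵥ (dil n s *ᵥ x) = Real.exp (-s) • (dil n s *ᵥ (chainMatrix n *ᵥ x)) := by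
  ext i
  simp only [chainMatrix_mulVec_apply, dil_mulVec_apply, Pi.smul_apply, smul_eq_mul]
  split_ifs with h
  · rw [← mul_assoc, ← Real.exp_add]
    congr 2
    push_cast
    ring
  · simp

theorem dil_mulVec_inputVec (n : ℕ) (s : ℝ) :
    dil n s *ᵥ inputVec n = Real.exp s • inputVec n := by
  ext i
  simp only [dil_mulVec_apply, inputVec, Pi.smul_apply, smul_eq_mul]
  split_ifs with h
  · have : (n : ℝ) = (i : ℕ) + 1 := by exact_mod_cast h.symm
    rw [this]; ring_nf
  · simp

theorem closedLoopMatrix_mulVec (n : ℕ) [NeZero n] (lam : ℝ) (x : Fin n → ℝ) :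
    closedLoopMatrix n lam *ᵥ x = chainMatrix n *ᵥ x + (gain n lam ⬝ᵥ x) • inputVec n := by
  rw [closedLoopMatrix, add_mulVec, vecMulVec_mulVec]
  simp

/-- If the state `z = d(s) x` is fed back into the chain at `x`, the velocity of `x` is mapped by
`d(s)` to `e^s` times the linear closed loop at `z`. -/
theorem dil_mulVec_loop (n : ℕ) [NeZero n] (lam s : ℝ) (x : Fin n → ℝ) :
    dil n s *ᵥ (chainMatrix n *ᵥ x + (gain n lam ⬝ᵥ (dil n s *ᵥ x)) • inputVec n) =
      Real.exp s • (closedLoopMatrix n lam *ᵥ (dil n s *ᵥ x)) := by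
  rw [closedLoopMatrix_mulVec, chainMatrix_mulVec_dil, mulVec_add, mulVec_smul,
    dil_mulVec_inputVec, smul_add, smul_smul (Real.exp s) (Real.exp (-s)), ← Real.exp_add,
    smul_comm (gain n lam ⬝ᵥ _)]
  simp

theorem chainRow_zero (n : ℕ) [NeZero n] (lam : ℝ) :
    chainRow n lam 0 = -Pi.single (0 : Fin n) (1 : ℝ) := by
  simp [chainRow]

theorem chainRow_vecMul_chainMatrix (n : ℕ) [NeZero n] (lam : ℝ) (k : ℕ) :
    chainRow n lam k ᵥ* chainMatrix n = chainRow n lam (k + 1) - lam • chainRow n lam k := by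
  rw [eq_sub_iff_add_eq]
  simp only [chainRow, pow_succ, ← vecMul_vecMul, vecMul_add, vecMul_smul, neg_vecMul, vecMul_one]
  rw [neg_add, smul_neg]

/-- The binomial theorem for the rows: entry `j` of `-e₁ᵀ (A + λ I)ᵏ` is `-C(k, j) λ^(k - j)`. -/
theorem chainRow_apply (n : ℕ) [NeZero n] (lam : ℝ) (k : ℕ) (j : Fin n) :
    chainRow n lam k j = -((k.choose j : ℝ) * lam ^ (k - (j : ℕ))) := by
  induction k generalizing j with
  | zero =>
    rw [chainRow_zero]
    by_cases h : j = 0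
    · subst h; simp
    · have : (j : ℕ) ≠ 0 := fun h' => h (Fin.ext (by simpa using h'))
      simp [h, Nat.choose_eq_zero_of_lt (Nat.pos_of_ne_zero this)]
  | succ k ih =>
    have h := congrFun (chainRow_vecMul_chainMatrix n lam k) j
    rw [vecMul_chainMatrix_apply, Pi.sub_apply, Pi.smul_apply, smul_eq_mul, eq_sub_iff_add_eq] at h
    rw [← h]
    split_ifs with hj
    · simp [ih, hj, pow_succ, mul_comm]
    · rw [ih, ih]
      obtain ⟨m, hm⟩ : ∃ m, (j : ℕ) = m + 1 := ⟨j - 1, by omega⟩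
      simp only [hm, Nat.add_sub_cancel, Nat.choose_succ_succ, Nat.add_sub_add_right]
      rcases lt_or_ge m k with hk | hk
      · obtain ⟨d, rfl⟩ : ∃ d, k = m + 1 + d := ⟨k - (m + 1), by omega⟩
        rw [show m + 1 + d - m = d + 1 by omega, show m + 1 + d - (m + 1) = d by omega]
        push_cast
        ring
      · rw [Nat.choose_eq_zero_of_lt (show k < m + 1 by omega)]
        simp

theorem chainRow_dotProduct_inputVec_of_lt {n : ℕ} [NeZero n] (lam : ℝ) {k : ℕ} (hk : k + 1 < n) :
    chainRow n lam k ⬝ᵥ inputVec n = 0 := by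
  refine Finset.sum_eq_zero fun j _ => ?_
  simp only [inputVec]
  split_ifs with h
  · rw [chainRow_apply, Nat.choose_eq_zero_of_lt (by omega)]; simp
  · simp

theorem chainRow_dotProduct_inputVec_last {n : ℕ} [NeZero n] (lam : ℝ) {k : ℕ} (hk : k + 1 = n) :
    chainRow n lam k ⬝ᵥ inputVec n = -1 := by
  rw [dotProduct, Finset.sum_eq_single ⟨k, by omega⟩]
  · simp [inputVec, hk, chainRow_apply]
  · intro j _ hj
    have : (j : ℕ) + 1 ≠ n := fun h => hj (Fin.ext (by simp only; omega))
    simp [inputVec, this]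
  · simp

/-- In the coordinates `hᵢ x` the linear closed loop is a chain of first-order lags. -/
theorem barrierRow_vecMul_closedLoopMatrix (n : ℕ) [NeZero n] (lam : ℝ) (k : Fin n) :
    barrierRow n lam k ᵥ* closedLoopMatrix n lam =
      (if h : (k : ℕ) + 1 < n then barrierRow n lam ⟨k + 1, h⟩ else 0)
        - lam • barrierRow n lam k := by
  rw [closedLoopMatrix, vecMul_add, vecMul_vecMulVec]
  simp only [barrierRow, chainRow_vecMul_chainMatrix]
  split_ifs with h
  · rw [chainRow_dotProduct_inputVec_of_lt lam h]; simp
  · have hk : (k : ℕ) + 1 = n := by omega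
    rw [chainRow_dotProduct_inputVec_last lam hk, hk, gain, neg_one_smul, zero_sub]
    abel

/-- In the coordinates `hᵢ x` the generator of the dilation is lower bidiagonal, with
nonnegative entries below the diagonal. -/
theorem barrierRow_vecMul_dilGen (n : ℕ) [NeZero n] (lam : ℝ) (k : Fin n) :
    barrierRow n lam k ᵥ* dilGen n =
      ((n : ℝ) - (k : ℕ)) • barrierRow n lam k +
        (((k : ℕ) : ℝ) * lam) • barrierRow n lam ⟨k - 1, by omega⟩ := by
  ext j
  simp only [dilGen, vecMul_diagonal, barrierRow, chainRow_apply, Pi.add_apply, Pi.smul_apply,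
    smul_eq_mul]
  obtain ⟨k, hk⟩ := k
  rcases k with _ | k
  · rcases Nat.eq_zero_or_pos (j : ℕ) with h | h
    · simp [h]
    · simp [Nat.choose_eq_zero_of_lt h]
  · simp only [Nat.add_sub_cancel]
    rcases lt_trichotomy (j : ℕ) (k + 1) with h | h | h
    · obtain ⟨d, rfl⟩ : ∃ d, k = j + d := ⟨k - j, by omega⟩
      have e2 := Nat.choose_mul_succ_eq (j + d) j
      have e3 : (((j + d).choose j : ℕ) : ℝ) * ((j : ℕ) + d + 1)
          = ((j + d + 1).choose j : ℕ) * ((d : ℝ) + 1) := by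
        have : (j : ℕ) + d + 1 - j = d + 1 := by omega
        rw [this] at e2
        exact_mod_cast e2
      rw [show (j : ℕ) + d + 1 - j = d + 1 by omega, show (j : ℕ) + d - j = d by omega]
      push_cast
      linear_combination (lam ^ (d + 1)) * e3
    · rw [h, Nat.choose_succ_self]
      push_cast; ring
    · rw [Nat.choose_eq_zero_of_lt h, Nat.choose_eq_zero_of_lt (show k < j by omega)]
      simp

/-- The barrier rows are linearly independent: they form a lower triangular matrix with `-1` on the
diagonal. -/
theorem eq_zero_of_barrierRow_dotProduct_eq_zero {n : ℕ} [NeZero n] {lam : ℝ} {x : Fin n → ℝ}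
    (h : ∀ k, barrierRow n lam k ⬝ᵥ x = 0) : x = 0 := by
  suffices ∀ m : ℕ, ∀ j : Fin n, (j : ℕ) = m → x j = 0 from funext fun j => this j j rfl
  intro m
  induction m using Nat.strong_induction_on with
  | _ m ih =>
    intro j hj
    have hk := h j
    rw [dotProduct, Finset.sum_eq_single j] at hk
    · simpa [barrierRow, chainRow_apply] using hk
    · intro i _ hij
      rcases lt_or_ge (i : ℕ) j with hlt | hge
      · rw [ih i (by omega) i rfl, mul_zero]
      · have : (j : ℕ) < i := lt_of_le_of_ne hge fun h' => hij (Fin.ext h'.symm)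
        simp [barrierRow, chainRow_apply, Nat.choose_eq_zero_of_lt this]
    · simp

/-! ### Bounds for quadratic forms -/

/-- A positive definite matrix dominates a multiple of the squared (supremum) norm. -/
theorem exists_pos_mul_norm_sq_le {n : ℕ} {M : Matrix (Fin n) (Fin n) ℝ} (hM : M.PosDef) :
    ∃ c : ℝ, 0 < c ∧ ∀ x : Fin n → ℝ, c * ‖x‖ ^ 2 ≤ x ⬝ᵥ (M *ᵥ x) := by
  rcases subsingleton_or_nontrivial (Fin n → ℝ) with hs | hs
  · exact ⟨1, one_pos, fun x => by simp [Subsingleton.elim x 0]⟩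
  have hcont : Continuous fun x : Fin n → ℝ => x ⬝ᵥ (M *ᵥ x) := by fun_prop
  obtain ⟨x₀, hx₀, hmin⟩ := (isCompact_sphere (0 : Fin n → ℝ) 1).exists_isMinOn
    (NormedSpace.sphere_nonempty.mpr zero_le_one) hcont.continuousOn
  have hx₀' : x₀ ≠ 0 := by
    rintro rfl
    simp at hx₀
  refine ⟨x₀ ⬝ᵥ (M *ᵥ x₀), by simpa using hM.dotProduct_mulVec_pos hx₀', fun x => ?_⟩
  rcases eq_or_ne x 0 with rfl | hx
  · simp
  have hx' : 0 < ‖x‖ := norm_pos_iff.mpr hx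
  have h := hmin (show ‖x‖⁻¹ • x ∈ Metric.sphere (0 : Fin n → ℝ) 1 by
    simp [norm_smul, hx'.ne'])
  simp only [Set.mem_ofPred_eq, mulVec_smul, smul_dotProduct, dotProduct_smul, smul_eq_mul] at h
  have h2 := mul_le_mul_of_nonneg_right h (sq_nonneg ‖x‖)
  refine h2.trans_eq ?_
  field_simp

theorem exists_pos_le_mul_norm_sq {n : ℕ} (M : Matrix (Fin n) (Fin n) ℝ) :
    ∃ C : ℝ, 0 < C ∧ ∀ x : Fin n → ℝ, |x ⬝ᵥ (M *ᵥ x)| ≤ C * ‖x‖ ^ 2 := by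
  refine ⟨∑ i, ∑ j, |M i j| + 1, by positivity, fun x => ?_⟩
  have hx : ∀ i, |x i| ≤ ‖x‖ := fun i => norm_le_pi_norm x i
  calc |x ⬝ᵥ (M *ᵥ x)| = |∑ i, ∑ j, x i * (M i j * x j)| := by
        simp only [dotProduct, mulVec, Finset.mul_sum]
    _ ≤ ∑ i, ∑ j, |x i * (M i j * x j)| :=
        (Finset.abs_sum_le_sum_abs _ _).trans
          (Finset.sum_le_sum fun i _ => Finset.abs_sum_le_sum_abs _ _)
    _ ≤ ∑ i, ∑ j, |M i j| * ‖x‖ ^ 2 := by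
        refine Finset.sum_le_sum fun i _ => Finset.sum_le_sum fun j _ => ?_
        rw [abs_mul, abs_mul]
        have := mul_le_mul (hx i) (hx j) (abs_nonneg _) (norm_nonneg _)
        nlinarith [abs_nonneg (M i j)]
    _ ≤ (∑ i, ∑ j, |M i j| + 1) * ‖x‖ ^ 2 := by
        simp only [← Finset.sum_mul]
        nlinarith [sq_nonneg ‖x‖]

/-- Positive definiteness is stable under small symmetric perturbations. -/
theorem exists_posDef_add_smul {n : ℕ} {M F : Matrix (Fin n) (Fin n) ℝ} (hM : M.PosDef)
    (hF : F.IsHermitian) : ∃ θ : ℝ, 0 < θ ∧ (M + θ • F).PosDef := by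
  obtain ⟨c, hc, hcM⟩ := exists_pos_mul_norm_sq_le hM
  obtain ⟨C, hC, hCF⟩ := exists_pos_le_mul_norm_sq F
  refine ⟨c / (2 * C), by positivity, .of_dotProduct_mulVec_pos ?_ fun x hx => ?_⟩
  · rw [IsHermitian, conjTranspose_add, conjTranspose_smul, hM.isHermitian.eq, hF.eq]
    simp
  · have hx' : 0 < ‖x‖ := norm_pos_iff.mpr hx
    rw [star_trivial, add_mulVec, smul_mulVec, dotProduct_add, dotProduct_smul, smul_eq_mul]
    have h2 := (abs_le.mp (hCF x)).1
    have h3 : c / (2 * C) * (-(C * ‖x‖ ^ 2)) ≤ c / (2 * C) * (x ⬝ᵥ F *ᵥ x) :=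
      mul_le_mul_of_nonneg_left h2 (by positivity)
    have h4 : c / (2 * C) * (-(C * ‖x‖ ^ 2)) = -(c * ‖x‖ ^ 2 / 2) := by field_simp
    have h5 : 0 < c * ‖x‖ ^ 2 := by positivity
    linarith [hcM x]

/-! ### Feasibility of the linear matrix inequalities -/

/-- The symmetric Pascal matrix, with entries `C(i + j, i)`. -/
def pascal (N : ℕ) : Matrix (Fin N) (Fin N) ℝ :=
  Matrix.of fun i j => (((i : ℕ) + j).choose i : ℝ)

/-- The Pascal matrix is `L Lᵀ` for the lower unitriangular matrix `L` of binomial coefficients,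
by Vandermonde's identity. -/
theorem pascal_posDef (N : ℕ) : (pascal N).PosDef := by
  let L : Matrix (Fin N) (Fin N) ℝ := Matrix.of fun i j => ((i : ℕ).choose j : ℝ)
  have hdet : L.det = 1 := by
    rw [det_of_isLowerTriangular]
    · simp [L]
    · intro i j hij
      have : (i : ℕ) < j := hij
      simp [L, Nat.choose_eq_zero_of_lt this]
  have hL : pascal N = L * Lᴴ := by
    ext i k
    simp only [pascal, L, mul_apply, conjTranspose_apply, of_apply, star_trivial]
    rw [Fin.sum_univ_eq_sum_range (fun j => ((i : ℕ).choose j : ℝ) * ((k : ℕ).choose j : ℝ)) N,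
      add_comm, Nat.add_choose_eq, Finset.Nat.sum_antidiagonal_eq_sum_range_succ
      (fun a b => (k : ℕ).choose a * (i : ℕ).choose b)]
    push_cast
    refine Finset.sum_subset_zero_on_sdiff (Finset.range_mono i.2) ?_ ?_
    · intro j hj
      rw [Finset.mem_sdiff, Finset.mem_range, Finset.mem_range] at hj
      rw [Nat.choose_eq_zero_of_lt (show (i : ℕ) < j by omega)]
      simp
    · intro j hj
      rw [Nat.choose_symm (Nat.lt_succ_iff.mp (Finset.mem_range.mp hj)), mul_comm]
  rw [hL]
  refine PosDef.mul_conjTranspose_self L (vecMul_injective_of_isUnit ?_)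
  rw [isUnit_iff_isUnit_det, hdet]
  exact isUnit_one

theorem posDef_scale {n : ℕ} {M : Matrix (Fin n) (Fin n) ℝ} (hM : M.PosDef)
    {d : Fin n → ℝ} (hd : ∀ i, d i ≠ 0) :
    (Matrix.of fun i j => d i * d j * M i j).PosDef := by
  have : (Matrix.of fun i j => d i * d j * M i j) = (diagonal d)ᴴ * M * diagonal d := by
    ext i j
    simp
    ring
  rw [this]
  refine hM.conjTranspose_mul_mul_same (mulVec_injective_of_isUnit ?_)
  rw [isUnit_iff_isUnit_det, det_diagonal]
  exact (Finset.prod_ne_zero_iff.mpr fun i _ => hd i).isUnit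

/-- The common Gram matrix, in the coordinates `hᵢ x`: its entries are
`∫₀^∞ t^(a+b) / (a! b!) e^{-t/m} dt` with `a = n - 1 - k`, `b = n - 1 - l`. -/
def gram (n : ℕ) (m : ℝ) : Matrix (Fin n) (Fin n) ℝ :=
  Matrix.of fun k l => m ^ ((Fin.rev k : ℕ) + (Fin.rev l : ℕ) + 1) *
    (((Fin.rev k : ℕ) + (Fin.rev l : ℕ)).choose (Fin.rev k : ℕ) : ℝ)

theorem gram_posDef (n : ℕ) {m : ℝ} (hm : 0 < m) : (gram n m).PosDef := by
  have h1 : ((pascal n).submatrix (Fin.rev : Fin n → Fin n) Fin.rev).PosDef :=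
    (pascal_posDef n).submatrix Fin.rev_injective
  have h2 := (posDef_scale h1 (d := fun k => m ^ (Fin.rev k : ℕ))
    (fun i => by positivity)).smul hm
  convert h2 using 1
  ext k l
  simp only [gram, pascal, of_apply, Matrix.smul_apply, submatrix_apply, smul_eq_mul, pow_add,
    pow_one]
  ring

theorem gram_comm (n : ℕ) (m : ℝ) (k l : Fin n) : gram n m k l = gram n m l k := by
  simp only [gram, of_apply]
  rw [add_comm (Fin.rev k : ℕ), Nat.choose_symm_add]

/-- Pascal's rule, as a Lyapunov equation with a right-hand side of rank one. -/
theorem gram_lyapunov {n : ℕ} {m : ℝ} (hm : 0 < m) (k l : Fin n) :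
    (chainMatrix n * gram n m) k l + (chainMatrix n * gram n m) l k
      + (if (Fin.rev k : ℕ) = 0 ∧ (Fin.rev l : ℕ) = 0 then 1 else 0) = m⁻¹ * gram n m k l := by
  have key : ∀ k l : Fin n, (chainMatrix n * gram n m) k l =
      if (Fin.rev k : ℕ) = 0 then 0 else
        m ^ ((Fin.rev k : ℕ) + (Fin.rev l : ℕ)) *
          (((Fin.rev k : ℕ) + (Fin.rev l : ℕ) - 1).choose ((Fin.rev k : ℕ) - 1) : ℝ) := by
    intro k l
    have : (chainMatrix n * gram n m) k l = (chainMatrix n *ᵥ fun i => gram n m i l) k := rfl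
    rw [this, chainMatrix_mulVec_apply]
    have hk := Fin.val_rev k
    split_ifs with h1 h2 h2
    · omega
    · have h3 : (Fin.rev (⟨k + 1, h1⟩ : Fin n) : ℕ) = (Fin.rev k : ℕ) - 1 := by
        rw [Fin.val_rev, Fin.val_rev]; simp only; omega
      simp only [gram, of_apply, h3]
      congr 2
      · omega
      · congr 1; omega
    · rfl
    · omega
  rw [key, key]
  simp only [gram, of_apply]
  generalize (Fin.rev k : ℕ) = a
  generalize (Fin.rev l : ℕ) = b
  rcases a with _ | a <;> rcases b with _ | b
  · simp [hm.ne']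
  · simp [pow_succ]
    field_simp
  · simp [pow_succ]
    field_simp
  · simp only [Nat.add_eq_zero_iff, one_ne_zero, and_false, if_false, Nat.add_sub_cancel]
    rw [show a + 1 + (b + 1) - 1 = a + b + 1 by omega,
      show b + 1 + (a + 1) - 1 = a + b + 1 by omega, show a + 1 + (b + 1) = a + b + 1 + 1 by omega,
      show b + 1 + (a + 1) = a + b + 1 + 1 by omega, Nat.choose_succ_succ (a + b + 1) a,
      show (a + b + 1).choose b = (a + b + 1).choose (a + 1) from
        Nat.choose_symm_of_eq_add (by omega)]
    push_cast
    rw [pow_succ m (a + b + 1 + 1)]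
    field_simp
    ring

/-- The generator of the dilation in the coordinates `hᵢ x`. -/
def barrierGen (n : ℕ) (lam : ℝ) : Matrix (Fin n) (Fin n) ℝ :=
  Matrix.of fun k l => if k = l then (n : ℝ) - (k : ℕ) else
    if (l : ℕ) + 1 = (k : ℕ) then ((k : ℕ) : ℝ) * lam else 0

theorem barrierGen_mulVec_apply {n : ℕ} (lam : ℝ) (v : Fin n → ℝ) (k : Fin n) :
    (barrierGen n lam *ᵥ v) k =
      ((n : ℝ) - (k : ℕ)) * v k + ((k : ℕ) : ℝ) * lam * v ⟨k - 1, by omega⟩ := by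
  have h1 : ∀ l, barrierGen n lam k l = (if k = l then (n : ℝ) - (k : ℕ) else 0) +
      (if (⟨k - 1, by omega⟩ : Fin n) = l then ((k : ℕ) : ℝ) * lam else 0) := by
    intro l
    simp only [barrierGen, of_apply, Fin.ext_iff]
    rcases Nat.eq_zero_or_pos (k : ℕ) with h0 | h0
    · simp only [h0, Nat.cast_zero, zero_mul, ite_self, add_zero, sub_zero]
    · split_ifs <;> first | omega | simp
  simp only [mulVec, dotProduct, h1, add_mul, Finset.sum_add_distrib, ite_mul, zero_mul,
    Finset.sum_ite_eq, Finset.mem_univ, if_true]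

theorem barrierGen_mul_gram {n : ℕ} {lam m : ℝ} (k l : Fin n) :
    (barrierGen n lam * gram n m) k l =
      m ^ ((Fin.rev k : ℕ) + (Fin.rev l : ℕ) + 1) * (((Fin.rev k : ℕ) + 1) *
        (((Fin.rev k : ℕ) + (Fin.rev l : ℕ)).choose (Fin.rev k : ℕ) : ℝ) +
        (n - 1 - (Fin.rev k : ℕ)) * (lam * m) *
        (((Fin.rev k : ℕ) + (Fin.rev l : ℕ) + 1).choose ((Fin.rev k : ℕ) + 1) : ℝ)) := by
  have : (barrierGen n lam * gram n m) k l = (barrierGen n lam *ᵥ fun i => gram n m i l) k := rfl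
  rw [this, barrierGen_mulVec_apply]
  have hk := Fin.val_rev k
  have hk' : ((k : ℕ) : ℝ) = n - 1 - (Fin.rev k : ℕ) := by
    rw [hk, Nat.cast_sub (by omega)]
    push_cast; ring
  rcases Nat.eq_zero_or_pos (k : ℕ) with h0 | h0
  · simp only [← hk']
    simp only [h0, Nat.cast_zero, zero_mul, add_zero, gram, of_apply]
    have : (n : ℝ) = (Fin.rev k : ℕ) + 1 := by
      rw [h0] at hk'; push_cast at hk'; linarith
    rw [this]; ring
  · have h3 : (Fin.rev (⟨k - 1, by omega⟩ : Fin n) : ℕ) = (Fin.rev k : ℕ) + 1 := by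
      rw [Fin.val_rev, Fin.val_rev]; simp only; omega
    simp only [gram, of_apply, h3]
    rw [hk', show (Fin.rev k : ℕ) + 1 + (Fin.rev l : ℕ) = (Fin.rev k : ℕ) + (Fin.rev l : ℕ) + 1 by
      omega, pow_succ m ((Fin.rev k : ℕ) + (Fin.rev l : ℕ) + 1)]
    ring

theorem pascal_gen_identity (n a b : ℕ) :
    ((a : ℝ) + 1) * ((a + b).choose a : ℝ) + ((b : ℝ) + 1) * ((b + a).choose b : ℝ)
      + 1 / 2 * ((n - 1 - a) * ((a + b + 1).choose (a + 1) : ℝ)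
        + (n - 1 - b) * ((b + a + 1).choose (b + 1) : ℝ)) =
      ((a + b).choose a : ℝ) + n / 2 * ((a + 1 + (b + 1)).choose (a + 1) : ℝ) := by
  have e1 : ((a + b + 1).choose (a + 1) : ℝ) * (a + 1) = (a + b + 1) * ((a + b).choose a : ℝ) := by
    exact_mod_cast (Nat.add_one_mul_choose_eq (a + b) a).symm
  have e2 : ((b + a + 1).choose (b + 1) : ℝ) * (b + 1) = (b + a + 1) * ((b + a).choose b : ℝ) := by
    exact_mod_cast (Nat.add_one_mul_choose_eq (b + a) b).symm
  have e3 : ((b + a).choose b : ℝ) = ((a + b).choose a : ℝ) := by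
    rw [add_comm b a, Nat.choose_symm_add]
  have e4 : ((a + 1 + (b + 1)).choose (a + 1) : ℝ)
      = ((b + a + 1).choose (b + 1) : ℝ) + ((a + b + 1).choose (a + 1) : ℝ) := by
    rw [show a + 1 + (b + 1) = a + b + 1 + 1 by omega, Nat.choose_succ_succ,
      show (b + a + 1).choose (b + 1) = (a + b + 1).choose a by
        rw [add_comm b a]; exact Nat.choose_symm_of_eq_add (by omega)]
    push_cast; ring
  rw [e3] at e2 ⊢
  rw [e4]
  linear_combination (-1 / 2) * e1 + (-1 / 2) * e2

/-- For `m` slightly larger than `1 / (2 λ)`, the Gram matrix makes the symmetric part of the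
generator of the dilation positive definite. -/
theorem exists_gram_posDef (n : ℕ) [NeZero n] {lam : ℝ} (hlam : 0 < lam) :
    ∃ m : ℝ, 0 < m ∧ 1 < 2 * lam * m ∧
      (barrierGen n lam * gram n m + (barrierGen n lam * gram n m)ᵀ).PosDef := by
  let F : Matrix (Fin n) (Fin n) ℝ := Matrix.of fun k l =>
    ((n : ℝ) - 1 - (Fin.rev k : ℕ)) *
      (((Fin.rev k : ℕ) + (Fin.rev l : ℕ) + 1).choose ((Fin.rev k : ℕ) + 1) : ℝ) +
    (n - 1 - (Fin.rev l : ℕ)) *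
      (((Fin.rev l : ℕ) + (Fin.rev k : ℕ) + 1).choose ((Fin.rev l : ℕ) + 1) : ℝ)
  have hF : F.IsHermitian := by
    ext k l
    simp only [F, conjTranspose_apply, of_apply, star_trivial]
    ring
  let E : Matrix (Fin n) (Fin n) ℝ := (pascal n).submatrix Fin.rev Fin.rev +
    ((n : ℝ) / 2) • (pascal (n + 1)).submatrix (fun k : Fin n => (Fin.rev k).succ)
      (fun k : Fin n => (Fin.rev k).succ)
  have hn : (0 : ℝ) < n / 2 := by
    have := Nat.pos_of_ne_zero (NeZero.ne n)
    positivity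
  have hE : E.PosDef := by
    refine PosDef.add ((pascal_posDef n).submatrix Fin.rev_injective)
      (((pascal_posDef (n + 1)).submatrix ?_).smul hn)
    exact (Fin.succ_injective n).comp Fin.rev_injective
  obtain ⟨θ, hθ, hEF⟩ := exists_posDef_add_smul hE hF
  have hm : 0 < (1 / 2 + θ) / lam := by positivity
  have hlm : lam * ((1 / 2 + θ) / lam) = 1 / 2 + θ := by field_simp
  refine ⟨(1 / 2 + θ) / lam, hm, by linarith, ?_⟩
  generalize (1 / 2 + θ) / lam = m at hm hlm
  have h2 := (posDef_scale hEF (d := fun k => m ^ (Fin.rev k : ℕ))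
    (fun i => by positivity)).smul hm
  convert h2 using 1
  ext k l
  rw [Matrix.add_apply, transpose_apply, barrierGen_mul_gram, barrierGen_mul_gram, hlm]
  simp only [E, F, pascal, of_apply, Matrix.smul_apply, submatrix_apply, smul_eq_mul,
    Matrix.add_apply, Fin.val_succ]
  have := pascal_gen_identity n (Fin.rev k : ℕ) (Fin.rev l : ℕ)
  generalize (Fin.rev k : ℕ) = a at *
  generalize (Fin.rev l : ℕ) = b at *
  rw [← this, add_comm b a]
  ring

/-- The matrix whose rows are the barrier rows. -/
def barrierMatrix (n : ℕ) [NeZero n] (lam : ℝ) : Matrix (Fin n) (Fin n) ℝ :=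
  Matrix.of (barrierRow n lam)

theorem barrierMatrix_mulVec_injective (n : ℕ) [NeZero n] (lam : ℝ) :
    Function.Injective (barrierMatrix n lam).mulVec := by
  intro x y hxy
  rw [← sub_eq_zero]
  refine eq_zero_of_barrierRow_dotProduct_eq_zero (lam := lam) fun k => ?_
  have := congrFun hxy k
  rw [dotProduct_sub, sub_eq_zero]
  exact this

theorem barrierMatrix_mul_closedLoopMatrix (n : ℕ) [NeZero n] (lam : ℝ) :
    barrierMatrix n lam * closedLoopMatrix n lam =
      (chainMatrix n - lam • (1 : Matrix (Fin n) (Fin n) ℝ)) * barrierMatrix n lam := by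
  ext k l
  have h1 : (barrierMatrix n lam * closedLoopMatrix n lam) k l =
    (barrierRow n lam k ᵥ* closedLoopMatrix n lam) l := rfl
  have h2 : (chainMatrix n * barrierMatrix n lam) k l =
    (chainMatrix n *ᵥ fun i => barrierMatrix n lam i l) k := rfl
  rw [h1, barrierRow_vecMul_closedLoopMatrix, sub_mul, Matrix.sub_apply, h2,
    chainMatrix_mulVec_apply]
  simp only [Pi.sub_apply, Pi.smul_apply, smul_mul, one_mul, Matrix.smul_apply, barrierMatrix,
    of_apply]
  split_ifs <;> rfl

theorem barrierMatrix_mul_dilGen (n : ℕ) [NeZero n] (lam : ℝ) :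
    barrierMatrix n lam * dilGen n = barrierGen n lam * barrierMatrix n lam := by
  ext k l
  have h1 : (barrierMatrix n lam * dilGen n) k l = (barrierRow n lam k ᵥ* dilGen n) l := rfl
  have h2 : (barrierGen n lam * barrierMatrix n lam) k l =
    (barrierGen n lam *ᵥ fun i => barrierMatrix n lam i l) k := rfl
  rw [h1, barrierRow_vecMul_dilGen, h2, barrierGen_mulVec_apply]
  rfl

/-- A Lyapunov inequality for `Y` transported to one for `Hᵀ Y⁻¹ H`. -/
theorem posDef_lyapunov_of_dual {n : ℕ} {H Y M M' : Matrix (Fin n) (Fin n) ℝ}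
    (hH : Function.Injective H.mulVec) (hY : Y.PosDef) (hM : H * M = M' * H)
    (h : (M' * Y + (M' * Y)ᵀ).PosDef) :
    (Hᵀ * Y⁻¹ * H * M + Mᵀ * (Hᵀ * Y⁻¹ * H)).PosDef := by
  have hYu : IsUnit Y.det := (isUnit_iff_isUnit_det Y).mp hY.isUnit
  have hYt : Yᵀ = Y := by simpa using hY.isHermitian.eq
  have hYit : (Y⁻¹)ᵀ = Y⁻¹ := by rw [transpose_nonsing_inv, hYt]
  have e : Hᵀ * Y⁻¹ * H * M + Mᵀ * (Hᵀ * Y⁻¹ * H) =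
      (Y⁻¹ * H)ᴴ * (M' * Y + (M' * Y)ᵀ) * (Y⁻¹ * H) := by
    have hM' : Mᵀ * Hᵀ = Hᵀ * M'ᵀ := by rw [← transpose_mul, hM, transpose_mul]
    rw [conjTranspose_eq_transpose_of_trivial, transpose_mul, hYit, transpose_mul, hYt, mul_add,
      add_mul]
    congr 1
    · calc Hᵀ * Y⁻¹ * H * M = Hᵀ * Y⁻¹ * (M' * H) := by rw [Matrix.mul_assoc _ H, hM]
        _ = Hᵀ * Y⁻¹ * M' * (Y * Y⁻¹) * H := by
            rw [mul_nonsing_inv _ hYu, Matrix.mul_one]; simp only [Matrix.mul_assoc]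
        _ = _ := by simp only [Matrix.mul_assoc]
    · calc Mᵀ * (Hᵀ * Y⁻¹ * H) = Mᵀ * Hᵀ * Y⁻¹ * H := by simp only [Matrix.mul_assoc]
        _ = Hᵀ * (Y⁻¹ * Y) * M'ᵀ * Y⁻¹ * H := by rw [hM', nonsing_inv_mul _ hYu, Matrix.mul_one]
        _ = _ := by simp only [Matrix.mul_assoc]
  rw [e]
  refine h.conjTranspose_mul_mul_same ?_
  have h1 : Function.Injective (Y⁻¹).mulVec := mulVec_injective_of_isUnit hY.inv.isUnit
  intro x y hxy
  simp only [← mulVec_mulVec] at hxy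
  exact hH (h1 hxy)

/-- The linear matrix inequalities are feasible. -/
theorem exists_isLMISolution (n : ℕ) [NeZero n] {lam : ℝ} (hlam : 0 < lam) :
    ∃ P : Matrix (Fin n) (Fin n) ℝ, IsLMISolution n lam P := by
  obtain ⟨m, hm, hlm, hG⟩ := exists_gram_posDef n hlam
  have hY := gram_posDef n hm
  have hH := barrierMatrix_mulVec_injective n lam
  refine ⟨(barrierMatrix n lam)ᵀ * (gram n m)⁻¹ * barrierMatrix n lam, ?_, ?_, ?_⟩
  · have h := posDef_lyapunov_of_dual (M := -closedLoopMatrix n lam)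
      (M' := -(chainMatrix n - lam • (1 : Matrix (Fin n) (Fin n) ℝ))) hH hY
      (by rw [Matrix.mul_neg, barrierMatrix_mul_closedLoopMatrix, Matrix.neg_mul]) ?_
    · convert h using 1
      rw [lmiZ, transpose_neg, Matrix.mul_neg, Matrix.neg_mul]
      abel
    · -- `-(M' Y + Y M'ᵀ)` is a positive multiple of `Y` plus a diagonal matrix unit
      have e : -(chainMatrix n - lam • (1 : Matrix (Fin n) (Fin n) ℝ)) * gram n m +
          (-(chainMatrix n - lam • (1 : Matrix (Fin n) (Fin n) ℝ)) * gram n m)ᵀ =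
          (2 * lam - m⁻¹) • gram n m +
            diagonal fun k : Fin n => if (Fin.rev k : ℕ) = 0 then (1 : ℝ) else 0 := by
        ext k l
        have := gram_lyapunov hm k l
        have h2 : (if (Fin.rev k : ℕ) = 0 ∧ (Fin.rev l : ℕ) = 0 then (1 : ℝ) else 0) =
            diagonal (fun k : Fin n => if (Fin.rev k : ℕ) = 0 then (1 : ℝ) else 0) k l := by
          rw [diagonal_apply]
          rcases eq_or_ne k l with rfl | hkl
          · simp
          · have : ¬ ((Fin.rev k : ℕ) = 0 ∧ (Fin.rev l : ℕ) = 0) := fun h =>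
              hkl (Fin.rev_injective (Fin.ext (h.1.trans h.2.symm)))
            rw [if_neg this, if_neg hkl]
        rw [h2] at this
        simp only [Matrix.add_apply, transpose_apply, neg_sub, sub_mul, Matrix.sub_apply, smul_mul,
          one_mul, Matrix.smul_apply, smul_eq_mul, gram_comm n m l k]
        linarith
      rw [e]
      have hpos : 0 < 2 * lam - m⁻¹ := by
        rw [sub_pos, inv_lt_iff_one_lt_mul₀ hm]
        exact hlm
      exact (hY.smul hpos).add_posSemidef (PosSemidef.diagonal fun k => by
        dsimp only [Pi.zero_apply]; split_ifs <;> norm_num)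
  · have h := posDef_lyapunov_of_dual hH hY (barrierMatrix_mul_dilGen n lam) hG
    convert h using 1
    rw [lmiQ, dilGen, diagonal_transpose]
  · have h := hY.inv.conjTranspose_mul_mul_same hH
    simpa using h

/-! ### The decay rate -/

/-- The decay rate is positive, and it bounds the quadratic form of `Z` by that of `Q`. -/
theorem decayRate_spec {n : ℕ} [NeZero n] {lam : ℝ} {P : Matrix (Fin n) (Fin n) ℝ}
    (hP : IsLMISolution n lam P) :
    0 < decayRate n lam P ∧
      ∀ z : Fin n → ℝ, z ⬝ᵥ (lmiZ n lam P *ᵥ z) ≤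
        -decayRate n lam P * (z ⬝ᵥ (lmiQ n P *ᵥ z)) := by
  obtain ⟨hZ, hQ, -⟩ := hP
  set Q := lmiQ n P with hQdef
  set Z := lmiZ n lam P with hZdef
  set R := CFC.sqrt Q with hR
  have hRR : R * R = Q := CFC.sqrt_mul_sqrt_self Q hQ.posSemidef.nonneg
  have hRh : Rᴴ = R := (nonneg_iff_posSemidef.mp (CFC.sqrt_nonneg Q)).isHermitian.eq
  have hRu : IsUnit R.det := by
    have h1 : IsUnit Q.det := (isUnit_iff_isUnit_det Q).mp hQ.isUnit
    rw [← hRR, det_mul] at h1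
    exact isUnit_of_mul_isUnit_left h1
  have hRi : (R⁻¹)ᴴ = R⁻¹ := by rw [conjTranspose_nonsing_inv, hRh]
  set S := R⁻¹ * Z * R⁻¹ with hS
  have hSneg : (-S).PosDef := by
    have h1 : -S = (R⁻¹)ᴴ * (-Z) * R⁻¹ := by rw [hRi, hS]; simp
    rw [h1]
    refine hZ.conjTranspose_mul_mul_same (mulVec_injective_of_isUnit ?_)
    rw [isUnit_nonsing_inv_iff]
    exact (isUnit_iff_isUnit_det R).mpr hRu
  have hSh : S.IsHermitian := by simpa using hSneg.isHermitian.neg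
  have hspec := hSh.spectrum_real_eq_range_eigenvalues
  have hfin : (spectrum ℝ S).Finite := by rw [hspec]; exact Set.finite_range _
  have hne : (spectrum ℝ S).Nonempty := by rw [hspec]; exact Set.range_nonempty _
  have hmem : sSup (spectrum ℝ S) ∈ spectrum ℝ S := hne.csSup_mem hfin
  have hneg : sSup (spectrum ℝ S) < 0 := by
    have h1 : -sSup (spectrum ℝ S) ∈ spectrum ℝ (-S) := by
      rw [← spectrum.neg_eq]; simpa using hmem
    rw [hSneg.isHermitian.spectrum_real_eq_range_eigenvalues] at h1
    obtain ⟨i, hi⟩ := h1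
    have := hSneg.eigenvalues_pos i
    linarith
  have hdec : decayRate n lam P = -sSup (spectrum ℝ S) := rfl
  refine ⟨by rw [hdec]; linarith, fun z => ?_⟩
  have hle : S ≤ algebraMap ℝ _ (sSup (spectrum ℝ S)) :=
    le_algebraMap_of_spectrum_le (fun x hx => le_csSup hfin.bddAbove hx) hSh.isSelfAdjoint
  have h2 := (le_iff.mp hle).dotProduct_mulVec_nonneg (R *ᵥ z)
  have hRt : Rᵀ = R := by simpa using hRh
  have e1 : (R *ᵥ z) ⬝ᵥ (S *ᵥ (R *ᵥ z)) = z ⬝ᵥ (Z *ᵥ z) := by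
    rw [dotProduct_comm, dotProduct_mulVec, ← mulVec_transpose, dotProduct_comm, hRt, mulVec_mulVec,
      mulVec_mulVec]
    congr 2
    rw [hS]
    calc R * (R⁻¹ * Z * R⁻¹) * R = (R * R⁻¹) * Z * (R⁻¹ * R) := by simp only [Matrix.mul_assoc]
      _ = Z := by rw [mul_nonsing_inv _ hRu, nonsing_inv_mul _ hRu]; simp
  have e2 : (R *ᵥ z) ⬝ᵥ (R *ᵥ z) = z ⬝ᵥ (Q *ᵥ z) := by
    rw [dotProduct_mulVec, ← mulVec_transpose, dotProduct_comm, hRt, mulVec_mulVec, hRR]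
  rw [star_trivial, sub_mulVec, dotProduct_sub, e1, Algebra.algebraMap_eq_smul_one, smul_mulVec,
    one_mulVec, dotProduct_smul, e2, smul_eq_mul] at h2
  rw [hdec, neg_neg]
  linarith

/-! ### The level function and the homogeneous gauge -/

/-- The quadratic form `xᵀ M x`. -/
def quadForm {n : ℕ} (M : Matrix (Fin n) (Fin n) ℝ) (x : Fin n → ℝ) : ℝ := x ⬝ᵥ (M *ᵥ x)

theorem contDiff_quadForm {n : ℕ} (M : Matrix (Fin n) (Fin n) ℝ) {k : WithTop ℕ∞} :
    ContDiff ℝ k (quadForm M) := by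
  unfold quadForm mulVec dotProduct
  fun_prop

theorem continuous_quadForm {n : ℕ} (M : Matrix (Fin n) (Fin n) ℝ) : Continuous (quadForm M) :=
  (contDiff_quadForm M (k := 1)).continuous

theorem quadForm_neg {n : ℕ} (M : Matrix (Fin n) (Fin n) ℝ) (x : Fin n → ℝ) :
    quadForm M (-x) = quadForm M x := by
  simp [quadForm, mulVec_neg]

theorem quadForm_zero {n : ℕ} (M : Matrix (Fin n) (Fin n) ℝ) : quadForm M 0 = 0 := by
  simp [quadForm]

theorem quadForm_pos {n : ℕ} {M : Matrix (Fin n) (Fin n) ℝ} (hM : M.PosDef) {x : Fin n → ℝ}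
    (hx : x ≠ 0) : 0 < quadForm M x := by
  simpa [quadForm] using hM.dotProduct_mulVec_pos hx

theorem hasDerivAt_mulVec {n : ℕ} (M : Matrix (Fin n) (Fin n) ℝ) {z : ℝ → Fin n → ℝ}
    {v : Fin n → ℝ} {t : ℝ} (hz : HasDerivAt z v t) :
    HasDerivAt (fun t => M *ᵥ z t) (M *ᵥ v) t := by
  rw [hasDerivAt_pi] at hz ⊢
  intro i
  have := HasDerivAt.fun_sum fun (j : Fin n) (_ : j ∈ Finset.univ) => (hz j).const_mul (M i j)
  exact this

theorem hasDerivAt_quadForm {n : ℕ} (M : Matrix (Fin n) (Fin n) ℝ) {z : ℝ → Fin n → ℝ}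
    {v : Fin n → ℝ} {t : ℝ} (hz : HasDerivAt z v t) :
    HasDerivAt (fun t => quadForm M (z t)) (v ⬝ᵥ (M *ᵥ z t) + z t ⬝ᵥ (M *ᵥ v)) t := by
  have h := hasDerivAt_mulVec M hz
  rw [hasDerivAt_pi] at hz h
  have := HasDerivAt.fun_sum fun (i : Fin n) (_ : i ∈ Finset.univ) => (hz i).mul (h i)
  rw [Finset.sum_add_distrib] at this
  exact this

/-- The derivative of `xᵀ P x` along the linear vector field `M x`. -/
theorem dotProduct_add_dotProduct_eq_quadForm {n : ℕ} (P M : Matrix (Fin n) (Fin n) ℝ)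
    (z : Fin n → ℝ) :
    (M *ᵥ z) ⬝ᵥ (P *ᵥ z) + z ⬝ᵥ (P *ᵥ (M *ᵥ z)) = quadForm (P * M + Mᵀ * P) z := by
  rw [quadForm, add_mulVec, dotProduct_add, ← mulVec_mulVec, ← mulVec_mulVec, add_comm]
  congr 1
  rw [dotProduct_mulVec z, vecMul_transpose]

theorem dilGen_transpose (n : ℕ) : (dilGen n)ᵀ = dilGen n := by
  rw [dilGen, diagonal_transpose]

theorem hasDerivAt_dil_mulVec {n : ℕ} {T : ℝ → ℝ} {T' : ℝ} {x : ℝ → Fin n → ℝ} {v : Fin n → ℝ}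
    {t : ℝ} (hT : HasDerivAt T T' t) (hx : HasDerivAt x v t) :
    HasDerivAt (fun t => dil n (T t) *ᵥ x t)
      (T' • (dilGen n *ᵥ (dil n (T t) *ᵥ x t)) + dil n (T t) *ᵥ v) t := by
  rw [hasDerivAt_pi] at hx ⊢
  intro i
  simp only [dil_mulVec_apply, Pi.add_apply, Pi.smul_apply, dilGen_mulVec_apply, smul_eq_mul]
  convert! ((hT.mul_const ((n : ℝ) - (i : ℕ))).exp).mul (hx i) using 1
  ring

theorem contDiff_dil_mulVec (n : ℕ) {k : WithTop ℕ∞} :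
    ContDiff ℝ k fun p : (Fin n → ℝ) × ℝ => dil n p.2 *ᵥ p.1 := by
  rw [contDiff_pi]
  intro i
  simp only [dil_mulVec_apply]
  fun_prop

theorem norm_dil_mulVec_le {n : ℕ} {s : ℝ} (hs : s ≤ 0) (x : Fin n → ℝ) :
    ‖dil n s *ᵥ x‖ ≤ Real.exp s * ‖x‖ := by
  rw [pi_norm_le_iff_of_nonneg (by positivity)]
  intro i
  rw [dil_mulVec_apply, norm_mul, Real.norm_of_nonneg (Real.exp_nonneg _)]
  have hi : (1 : ℝ) ≤ (n : ℝ) - (i : ℕ) := by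
    have : ((i : ℕ) : ℝ) + 1 ≤ n := by exact_mod_cast i.2
    linarith
  have h1 : s * ((n : ℝ) - (i : ℕ)) ≤ s := by nlinarith
  exact mul_le_mul (Real.exp_le_exp.mpr h1) (norm_le_pi_norm x i) (norm_nonneg _)
    (Real.exp_nonneg _)

theorem le_norm_dil_mulVec {n : ℕ} {s : ℝ} (hs : 0 ≤ s) (x : Fin n → ℝ) :
    Real.exp s * ‖x‖ ≤ ‖dil n s *ᵥ x‖ := by
  have h := norm_dil_mulVec_le (neg_nonpos.mpr hs) (dil n s *ᵥ x)
  rw [dil_mulVec_dil_mulVec, neg_add_cancel, dil_zero, one_mulVec, Real.exp_neg] at h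
  rwa [inv_mul_eq_div, le_div_iff₀' (Real.exp_pos s)] at h

section Level

variable {n : ℕ} {P : Matrix (Fin n) (Fin n) ℝ} {r : ℝ}

theorem hasDerivAt_quadForm_dil (x : Fin n → ℝ) (s : ℝ) :
    HasDerivAt (fun s => quadForm P (dil n s *ᵥ x)) (quadForm (lmiQ n P) (dil n s *ᵥ x)) s := by
  have h := hasDerivAt_quadForm P (hasDerivAt_dil_mulVec (hasDerivAt_id' s)
    (hasDerivAt_const s x))
  simp only [mulVec_zero, add_zero, one_smul] at h
  rw [dotProduct_add_dotProduct_eq_quadForm, dilGen_transpose] at h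
  exact h

theorem strictMono_quadForm_dil (hQ : (lmiQ n P).PosDef) {x : Fin n → ℝ} (hx : x ≠ 0) :
    StrictMono fun s => quadForm P (dil n s *ᵥ x) := by
  refine strictMono_of_deriv_pos fun s => ?_
  rw [(hasDerivAt_quadForm_dil x s).deriv]
  exact quadForm_pos hQ (by rwa [Ne, dil_mulVec_eq_zero_iff])

theorem existsUnique_level (hP : P.PosDef) (hQ : (lmiQ n P).PosDef) (hr : 0 < r)
    {x : Fin n → ℝ} (hx : x ≠ 0) : ∃! s : ℝ, quadForm P (dil n s *ᵥ x) = r ^ 2 := by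
  have hmono := strictMono_quadForm_dil hQ hx
  have hcont : Continuous fun s => quadForm P (dil n s *ᵥ x) :=
    continuous_iff_continuousAt.mpr fun s => (hasDerivAt_quadForm_dil x s).continuousAt
  have hx' : 0 < ‖x‖ := norm_pos_iff.mpr hx
  obtain ⟨c, hc, hcP⟩ := exists_pos_mul_norm_sq_le hP
  obtain ⟨C, hC, hCP⟩ := exists_pos_le_mul_norm_sq P
  -- below this level the form is at most `r ^ 2`, by the upper bound `C ‖·‖²`
  obtain ⟨a, ha⟩ : ∃ a, quadForm P (dil n a *ᵥ x) ≤ r ^ 2 := by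
    have ht : Tendsto (fun s => C * (Real.exp s * ‖x‖) ^ 2) atBot (𝓝 0) := by
      have := (((Real.tendsto_exp_atBot.mul_const ‖x‖).pow 2).const_mul C)
      simpa using this
    obtain ⟨a, ha, ha0⟩ := ((ht.eventually_le_const (by positivity : 0 < r ^ 2)).and
      (eventually_le_atBot 0)).exists
    refine ⟨a, le_trans ((le_abs_self _).trans (hCP _)) (le_trans ?_ ha)⟩
    gcongr
    exact norm_dil_mulVec_le ha0 x
  obtain ⟨b, hb⟩ : ∃ b, r ^ 2 ≤ quadForm P (dil n b *ᵥ x) := by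
    have ht : Tendsto (fun s => c * (Real.exp s * ‖x‖) ^ 2) atTop atTop :=
      ((tendsto_pow_atTop two_ne_zero).comp
        (Real.tendsto_exp_atTop.atTop_mul_const hx')).const_mul_atTop hc
    obtain ⟨b, hb, hb0⟩ := ((ht.eventually_ge_atTop (r ^ 2)).and (eventually_ge_atTop 0)).exists
    refine ⟨b, hb.trans (le_trans ?_ (hcP _))⟩
    gcongr
    exact le_norm_dil_mulVec hb0 x
  obtain ⟨s, hs⟩ := mem_range_of_exists_le_of_exists_ge hcont ⟨a, ha⟩ ⟨b, hb⟩
  exact ⟨s, hs, fun s' hs' => hmono.injective (hs'.trans hs.symm)⟩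

/-- For `x ≠ 0`, the unique `τ` with `(d(τ) x)ᵀ P (d(τ) x) = r²`. In terms of the homogeneous norm
of the closed loop it is `s - ln ‖x / r‖_d`, which does not depend on `s`. -/
def level (P : Matrix (Fin n) (Fin n) ℝ) (r : ℝ) (x : Fin n → ℝ) : ℝ :=
  Classical.epsilon fun s : ℝ => quadForm P (dil n s *ᵥ x) = r ^ 2

/-- The homogeneous projection of `x ≠ 0` on the ellipsoid `xᵀ P x = r²`. -/
def sphereProj (P : Matrix (Fin n) (Fin n) ℝ) (r : ℝ) (x : Fin n → ℝ) : Fin n → ℝ :=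
  dil n (level P r x) *ᵥ x

open Classical in
/-- The homogeneous gauge `exp (-level x)`, vanishing at `0`; it is `e^{-s} ‖x / r‖_d`. -/
def gauge (P : Matrix (Fin n) (Fin n) ℝ) (r : ℝ) (x : Fin n → ℝ) : ℝ :=
  if x = 0 then 0 else Real.exp (-level P r x)

theorem quadForm_sphereProj (hP : P.PosDef) (hQ : (lmiQ n P).PosDef) (hr : 0 < r)
    {x : Fin n → ℝ} (hx : x ≠ 0) : quadForm P (sphereProj P r x) = r ^ 2 :=
  Classical.epsilon_spec (existsUnique_level hP hQ hr hx).exists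

theorem level_eq_of_quadForm (hP : P.PosDef) (hQ : (lmiQ n P).PosDef) (hr : 0 < r)
    {x : Fin n → ℝ} (hx : x ≠ 0) {s : ℝ} (hs : quadForm P (dil n s *ᵥ x) = r ^ 2) :
    level P r x = s :=
  (existsUnique_level hP hQ hr hx).unique (quadForm_sphereProj hP hQ hr hx) hs

theorem lt_level_of_quadForm_lt (hP : P.PosDef) (hQ : (lmiQ n P).PosDef) (hr : 0 < r)
    {x : Fin n → ℝ} (hx : x ≠ 0) {s : ℝ} (hs : quadForm P (dil n s *ᵥ x) < r ^ 2) :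
    s < level P r x := by
  rw [← quadForm_sphereProj hP hQ hr hx] at hs
  exact (strictMono_quadForm_dil hQ hx).lt_iff_lt.mp hs

theorem le_level_of_quadForm_le (hP : P.PosDef) (hQ : (lmiQ n P).PosDef) (hr : 0 < r)
    {x : Fin n → ℝ} (hx : x ≠ 0) {s : ℝ} (hs : quadForm P (dil n s *ᵥ x) ≤ r ^ 2) :
    s ≤ level P r x := by
  rw [← quadForm_sphereProj hP hQ hr hx] at hs
  exact (strictMono_quadForm_dil hQ hx).le_iff_le.mp hs

theorem level_neg (x : Fin n → ℝ) : level P r (-x) = level P r x := by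
  simp only [level, mulVec_neg, quadForm_neg]

theorem sphereProj_neg (x : Fin n → ℝ) : sphereProj P r (-x) = -sphereProj P r x := by
  rw [sphereProj, level_neg, mulVec_neg, sphereProj]

theorem sphereProj_zero : sphereProj P r (0 : Fin n → ℝ) = 0 := by
  simp [sphereProj]

theorem sphereProj_ne_zero {x : Fin n → ℝ} (hx : x ≠ 0) : sphereProj P r x ≠ 0 := by
  rwa [sphereProj, Ne, dil_mulVec_eq_zero_iff]

/-- The implicit function theorem applies because `xᵀ P x` increases strictly along the dilation. -/
theorem differentiableAt_level (hP : P.PosDef) (hQ : (lmiQ n P).PosDef) (hr : 0 < r)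
    {x : Fin n → ℝ} (hx : x ≠ 0) : DifferentiableAt ℝ (level P r) x := by
  let F : (Fin n → ℝ) × ℝ → ℝ := fun p => quadForm P (dil n p.2 *ᵥ p.1)
  have hF : ContDiff ℝ 1 F := (contDiff_quadForm P).comp (contDiff_dil_mulVec n)
  have dF := hF.contDiffAt.hasStrictFDerivAt (x := (x, level P r x)) one_ne_zero
  have hpart : HasDerivAt (fun s => F (x, s))
      ((fderiv ℝ F (x, level P r x) ∘L .inr ℝ (Fin n → ℝ) ℝ) 1) (level P r x) := by
    have h1 : HasDerivAt (fun s : ℝ => ((x, s) : (Fin n → ℝ) × ℝ)) (0, 1) (level P r x) :=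
      (hasDerivAt_const _ x).prodMk (hasDerivAt_id' _)
    exact dF.hasFDerivAt.comp_hasDerivAt (level P r x) h1
  have hval : (fderiv ℝ F (x, level P r x) ∘L .inr ℝ (Fin n → ℝ) ℝ) 1 =
      quadForm (lmiQ n P) (sphereProj P r x) :=
    hpart.unique (hasDerivAt_quadForm_dil x _)
  have hinv : (fderiv ℝ F (x, level P r x) ∘L .inr ℝ (Fin n → ℝ) ℝ).IsInvertible := by
    have hne : (fderiv ℝ F (x, level P r x) ∘L .inr ℝ (Fin n → ℝ) ℝ) 1 ≠ 0 := by
      rw [hval]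
      exact (quadForm_pos hQ (sphereProj_ne_zero hx)).ne'
    refine ⟨ContinuousLinearEquiv.unitsEquivAut ℝ (Units.mk0 _ hne), ?_⟩
    ext
    simp
  have h1 := dF.eventually_apply_implicitFunctionOfProdDomain hinv
  have h2 := (dF.hasStrictFDerivAt_implicitFunctionOfProdDomain hinv).hasFDerivAt
  refine (h2.congr_of_eventuallyEq ?_).differentiableAt
  filter_upwards [h1, isOpen_ne.mem_nhds hx] with y hy hy0
  refine level_eq_of_quadForm hP hQ hr hy0 ?_
  exact hy.trans (quadForm_sphereProj hP hQ hr hx)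

theorem continuousAt_sphereProj (hP : P.PosDef) (hQ : (lmiQ n P).PosDef) (hr : 0 < r)
    {x : Fin n → ℝ} (hx : x ≠ 0) : ContinuousAt (sphereProj P r) x :=
  ((contDiff_dil_mulVec n (k := 1)).continuous.continuousAt).comp
    (continuousAt_id.prodMk (differentiableAt_level hP hQ hr hx).continuousAt)

theorem gauge_zero : gauge P r (0 : Fin n → ℝ) = 0 := if_pos rfl

theorem gauge_of_ne {x : Fin n → ℝ} (hx : x ≠ 0) : gauge P r x = Real.exp (-level P r x) :=
  if_neg hx

theorem gauge_nonneg (x : Fin n → ℝ) : 0 ≤ gauge P r x := by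
  unfold gauge; split_ifs <;> positivity

theorem gauge_pos_iff {x : Fin n → ℝ} : 0 < gauge P r x ↔ x ≠ 0 := by
  refine ⟨?_, fun hx => by rw [gauge_of_ne hx]; positivity⟩
  rintro h rfl
  exact h.ne' gauge_zero

theorem continuous_gauge (hP : P.PosDef) (hQ : (lmiQ n P).PosDef) (hr : 0 < r) :
    Continuous (gauge P r) := by
  refine continuous_iff_continuousAt.mpr fun x => ?_
  rcases eq_or_ne x 0 with rfl | hx
  · rw [ContinuousAt, gauge_zero, tendsto_order]
    refine ⟨fun a ha => Eventually.of_forall fun y => ha.trans_le (gauge_nonneg y),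
      fun a ha => ?_⟩
    have hcont : Continuous fun y : Fin n → ℝ => quadForm P (dil n (-Real.log a) *ᵥ y) :=
      (continuous_quadForm P).comp (by fun_prop)
    have h0 : quadForm P (dil n (-Real.log a) *ᵥ (0 : Fin n → ℝ)) < r ^ 2 := by
      rw [mulVec_zero, quadForm_zero]; positivity
    filter_upwards [hcont.continuousAt.eventually_lt_const h0] with y hy
    rcases eq_or_ne y 0 with rfl | hy0
    · rwa [gauge_zero]
    · rw [gauge_of_ne hy0, ← Real.lt_log_iff_exp_lt ha]
      linarith [lt_level_of_quadForm_lt hP hQ hr hy0 hy]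
  · have h1 : ContinuousAt (fun y => Real.exp (-level P r y)) x :=
      (differentiableAt_level hP hQ hr hx).continuousAt.neg.rexp
    refine h1.congr ?_
    filter_upwards [isOpen_ne.mem_nhds hx] with y hy using (gauge_of_ne hy).symm

theorem exists_norm_sphereProj_le (hP : P.PosDef) (hQ : (lmiQ n P).PosDef) (hr : 0 < r) :
    ∃ R : ℝ, 0 < R ∧ ∀ x : Fin n → ℝ, ‖sphereProj P r x‖ ≤ R := by
  obtain ⟨c, hc, hcP⟩ := exists_pos_mul_norm_sq_le hP
  refine ⟨r / Real.sqrt c, by positivity, fun x => ?_⟩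
  rcases eq_or_ne x 0 with rfl | hx
  · rw [sphereProj_zero, norm_zero]; positivity
  · have h := hcP (sphereProj P r x)
    change _ ≤ quadForm P _ at h
    rw [quadForm_sphereProj hP hQ hr hx] at h
    refine (pow_le_pow_iff_left₀ (norm_nonneg _) (by positivity) two_ne_zero).mp ?_
    rw [div_pow, Real.sq_sqrt hc.le, le_div_iff₀ hc]
    linarith

theorem dil_neg_level_sphereProj (x : Fin n → ℝ) :
    dil n (-level P r x) *ᵥ sphereProj P r x = x := by
  rw [sphereProj, dil_mulVec_dil_mulVec, neg_add_cancel, dil_zero, one_mulVec]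

/-- A small gauge forces a small norm. -/
theorem exists_gauge_lt_imp_norm_lt (hP : P.PosDef) (hQ : (lmiQ n P).PosDef) (hr : 0 < r) {ε : ℝ}
    (hε : 0 < ε) : ∃ η : ℝ, 0 < η ∧ ∀ x : Fin n → ℝ, gauge P r x < η → ‖x‖ < ε := by
  obtain ⟨R, hR, hRx⟩ := exists_norm_sphereProj_le hP hQ hr
  refine ⟨min 1 (ε / R), by positivity, fun x hx => ?_⟩
  rcases eq_or_ne x 0 with rfl | hx0
  · simpa using hε
  rw [gauge_of_ne hx0] at hx
  have h1 : -level P r x ≤ 0 := by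
    have := hx.trans_le (min_le_left _ _)
    rw [Real.exp_lt_one_iff] at this
    exact this.le
  calc ‖x‖ = ‖dil n (-level P r x) *ᵥ sphereProj P r x‖ := by rw [dil_neg_level_sphereProj]
    _ ≤ Real.exp (-level P r x) * ‖sphereProj P r x‖ := norm_dil_mulVec_le h1 _
    _ ≤ Real.exp (-level P r x) * R := by gcongr; exact hRx x
    _ < ε / R * R := by gcongr; exact hx.trans_le (min_le_right _ _)
    _ = ε := by field_simp

end Level

/-! ### The closed loop in homogeneous coordinates -/

section Feedback

variable {n : ℕ} {P : Matrix (Fin n) (Fin n) ℝ} {r : ℝ}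

theorem weightedNorm_scaledWeight_eq_one_iff (hr : 0 < r) (s σ : ℝ)
    (x : Fin n → ℝ) :
    weightedNorm (scaledWeight P s) (dil n (-σ) *ᵥ (r⁻¹ • x)) = 1 ↔
      quadForm P (dil n (s - σ) *ᵥ x) = r ^ 2 := by
  have e : (dil n (-σ) *ᵥ (r⁻¹ • x)) ⬝ᵥ (scaledWeight P s *ᵥ (dil n (-σ) *ᵥ (r⁻¹ • x))) =
      quadForm P (dil n (s - σ) *ᵥ x) / r ^ 2 := by
    rw [scaledWeight, ← mulVec_mulVec, ← mulVec_mulVec, dil_mulVec_dil_mulVec, dotProduct_mulVec,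
      ← mulVec_transpose, dil_transpose, dil_mulVec_dil_mulVec, mulVec_smul, mulVec_smul,
      smul_dotProduct, dotProduct_smul, ← sub_eq_add_neg, quadForm, smul_eq_mul, smul_eq_mul]
    field_simp
  rw [weightedNorm, e, Real.sqrt_eq_one, div_eq_one_iff_eq (by positivity)]

theorem quadForm_dil_eq_sq_weightedNorm (hP : P.PosDef) (s : ℝ) (x : Fin n → ℝ) :
    quadForm P (dil n s *ᵥ x) = weightedNorm (scaledWeight P s) x ^ 2 := by
  have e : x ⬝ᵥ (scaledWeight P s *ᵥ x) = quadForm P (dil n s *ᵥ x) := by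
    rw [scaledWeight, ← mulVec_mulVec, ← mulVec_mulVec, dotProduct_mulVec,
      ← mulVec_transpose, dil_transpose, quadForm]
  rw [weightedNorm, e, Real.sq_sqrt]
  simpa [quadForm] using hP.posSemidef.dotProduct_mulVec_nonneg (dil n s *ᵥ x)

theorem homNorm_eq_exp (hP : P.PosDef) (hQ : (lmiQ n P).PosDef) (hr : 0 < r) (s : ℝ)
    {x : Fin n → ℝ} (hx : x ≠ 0) :
    homNorm (scaledWeight P s) (r⁻¹ • x) = Real.exp (s - level P r x) := by
  rw [homNorm, if_neg (smul_ne_zero (inv_ne_zero hr.ne') hx)]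
  simp only [weightedNorm_scaledWeight_eq_one_iff hr]
  congr 1
  have hex : ∃ σ : ℝ, quadForm P (dil n (s - σ) *ᵥ x) = r ^ 2 :=
    ⟨s - level P r x, by rw [sub_sub_cancel]; exact quadForm_sphereProj hP hQ hr hx⟩
  have := level_eq_of_quadForm hP hQ hr hx (Classical.epsilon_spec hex)
  linarith

theorem dil_mulVec_homProj (hP : P.PosDef) (hQ : (lmiQ n P).PosDef) (hr : 0 < r) (s : ℝ)
    (x : Fin n → ℝ) : dil n s *ᵥ homProj P s r x = sphereProj P r x := by
  rcases eq_or_ne x 0 with rfl | hx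
  · simp [homProj, sphereProj]
  · rw [homProj, homNorm_eq_exp hP hQ hr s hx, Real.log_exp, dil_mulVec_dil_mulVec, sphereProj]
    congr 2
    ring

theorem vecMul_dil_dotProduct_homProj (hP : P.PosDef) (hQ : (lmiQ n P).PosDef) (hr : 0 < r) (s : ℝ)
    (h x : Fin n → ℝ) : (h ᵥ* dil n s) ⬝ᵥ homProj P s r x = h ⬝ᵥ sphereProj P r x := by
  rw [← dotProduct_mulVec, dil_mulVec_homProj hP hQ hr]

theorem closedLoop_eq [NeZero n] {lam : ℝ} (hP : P.PosDef) (hQ : (lmiQ n P).PosDef) (hr : 0 < r)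
    (s : ℝ) (x : Fin n → ℝ) :
    closedLoop n lam P s r x =
      chainMatrix n *ᵥ x + (gain n lam ⬝ᵥ sphereProj P r x) • inputVec n := by
  rw [closedLoop, homFeedback, vecMul_dil_dotProduct_homProj hP hQ hr]

theorem mem_homCone_iff [NeZero n] {lam : ℝ} (hP : P.PosDef) (hQ : (lmiQ n P).PosDef) (hr : 0 < r)
    (s : ℝ) (x : Fin n → ℝ) :
    x ∈ homCone n lam P s r ↔ ∀ i, 0 ≤ barrierRow n lam i ⬝ᵥ sphereProj P r x := by
  simp only [homCone, Set.mem_ofPred_eq, vecMul_dil_dotProduct_homProj hP hQ hr]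

theorem closedLoop_neg [NeZero n] {lam : ℝ} (hP : P.PosDef) (hQ : (lmiQ n P).PosDef) (hr : 0 < r)
    (s : ℝ) (x : Fin n → ℝ) : closedLoop n lam P s r (-x) = -closedLoop n lam P s r x := by
  simp only [closedLoop_eq hP hQ hr, sphereProj_neg, mulVec_neg, dotProduct_neg, neg_smul, neg_add]

theorem continuousAt_closedLoop [NeZero n] {lam : ℝ} (hP : P.PosDef) (hQ : (lmiQ n P).PosDef)
    (hr : 0 < r) (s : ℝ) {x : Fin n → ℝ} (hx : x ≠ 0) :
    ContinuousAt (closedLoop n lam P s r) x := by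
  have h1 := continuousAt_sphereProj hP hQ hr hx
  have h2 : closedLoop n lam P s r = fun x =>
      chainMatrix n *ᵥ x + (gain n lam ⬝ᵥ sphereProj P r x) • inputVec n :=
    funext (closedLoop_eq hP hQ hr s)
  have h3 : ContinuousAt (fun x => gain n lam ⬝ᵥ sphereProj P r x) x :=
    (show Continuous fun y : Fin n → ℝ => gain n lam ⬝ᵥ y by fun_prop).continuousAt.comp h1
  rw [h2]
  exact (show Continuous fun y : Fin n → ℝ => chainMatrix n *ᵥ y by fun_prop).continuousAt.add
    (h3.smul continuousAt_const)

theorem exists_norm_closedLoop_le [NeZero n] (lam : ℝ) (hP : P.PosDef) (hQ : (lmiQ n P).PosDef)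
    (hr : 0 < r) (s B : ℝ) :
    ∃ C : ℝ, ∀ x : Fin n → ℝ, ‖x‖ ≤ B → ‖closedLoop n lam P s r x‖ ≤ C := by
  obtain ⟨R, hR, hRx⟩ := exists_norm_sphereProj_le hP hQ hr
  let g : (Fin n → ℝ) × (Fin n → ℝ) → Fin n → ℝ := fun p =>
    chainMatrix n *ᵥ p.1 + (gain n lam ⬝ᵥ p.2) • inputVec n
  have hg : Continuous g := by fun_prop
  obtain ⟨C, hC⟩ := ((isCompact_closedBall (0 : Fin n → ℝ) B).prod
    (isCompact_closedBall (0 : Fin n → ℝ) R)).exists_bound_of_continuousOn hg.continuousOn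
  refine ⟨C, fun x hx => ?_⟩
  rw [closedLoop_eq hP hQ hr]
  exact hC (x, sphereProj P r x) ⟨by simpa using hx, by simpa using hRx x⟩

/-- In the projected coordinates the closed loop is the linear closed loop. -/
theorem dil_level_mulVec_closedLoop [NeZero n] {lam : ℝ} (hP : P.PosDef) (hQ : (lmiQ n P).PosDef)
    (hr : 0 < r) (s : ℝ) (x : Fin n → ℝ) :
    dil n (level P r x) *ᵥ closedLoop n lam P s r x =
      Real.exp (level P r x) • (closedLoopMatrix n lam *ᵥ sphereProj P r x) := by
  rw [closedLoop_eq hP hQ hr]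
  exact dil_mulVec_loop n lam (level P r x) x

/-- The relative decay `κ(z) = -(zᵀ Z z) / (zᵀ Q z)` of the homogeneous norm. -/
def relDecay (n : ℕ) [NeZero n] (lam : ℝ) (P : Matrix (Fin n) (Fin n) ℝ) (z : Fin n → ℝ) : ℝ :=
  -quadForm (lmiZ n lam P) z / quadForm (lmiQ n P) z

theorem decayRate_le_relDecay [NeZero n] {lam : ℝ} (hL : IsLMISolution n lam P) {z : Fin n → ℝ}
    (hz : z ≠ 0) : decayRate n lam P ≤ relDecay n lam P z := by
  have h := (decayRate_spec hL).2 z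
  rw [relDecay, le_div_iff₀ (quadForm_pos hL.2.1 hz)]
  change quadForm _ z ≤ _ * quadForm _ z at h
  linarith

theorem continuousAt_relDecay [NeZero n] {lam : ℝ} (hL : IsLMISolution n lam P) {z : Fin n → ℝ}
    (hz : z ≠ 0) : ContinuousAt (relDecay n lam P) z :=
  ((continuous_quadForm _).neg.continuousAt).div (continuous_quadForm _).continuousAt
    (quadForm_pos hL.2.1 hz).ne'

/-- Differentiating `(d(level) x)ᵀ P (d(level) x) = r²` along a classical solution gives the speed
of the level. -/
theorem hasDerivAt_level_comp [NeZero n] {lam s : ℝ} (hL : IsLMISolution n lam P) (hr : 0 < r)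
    {x : ℝ → Fin n → ℝ} {t : ℝ} (hx : HasDerivAt x (closedLoop n lam P s r (x t)) t)
    (hx0 : x t ≠ 0) :
    HasDerivAt (fun t => level P r (x t))
      (Real.exp (level P r (x t)) * relDecay n lam P (sphereProj P r (x t))) t := by
  obtain ⟨-, hQ, hP⟩ := hL
  have hd := (differentiableAt_level hP hQ hr hx0).hasFDerivAt.comp_hasDerivAt t hx
  set T' := (fderiv ℝ (level P r) (x t)) (closedLoop n lam P s r (x t)) with hT'
  have hz := hasDerivAt_dil_mulVec hd hx
  have hq := hasDerivAt_quadForm P hz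
  have hconst : HasDerivAt
      (fun t => quadForm P (dil n ((level P r ∘ x) t) *ᵥ x t)) 0 t := by
    refine (hasDerivAt_const t (r ^ 2)).congr_of_eventuallyEq ?_
    filter_upwards [hx.continuousAt.eventually_ne hx0] with u hu
    exact quadForm_sphereProj hP hQ hr hu
  have h0 := hq.unique hconst
  have e1 : dil n ((level P r ∘ x) t) *ᵥ x t = sphereProj P r (x t) := rfl
  have e2 : dil n ((level P r ∘ x) t) *ᵥ closedLoop n lam P s r (x t) = _ :=
    dil_level_mulVec_closedLoop hP hQ hr s (x t)
  set z := sphereProj P r (x t) with hzdef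
  have hzQ := quadForm_pos hQ (sphereProj_ne_zero (P := P) (r := r) hx0)
  rw [e2, e1] at h0
  have a1 := dotProduct_add_dotProduct_eq_quadForm P (dilGen n) z
  have a2 := dotProduct_add_dotProduct_eq_quadForm P (closedLoopMatrix n lam) z
  rw [dilGen_transpose] at a1
  change _ = quadForm (lmiQ n P) z at a1
  change _ = quadForm (lmiZ n lam P) z at a2
  simp only [add_dotProduct, mulVec_add, dotProduct_add, smul_dotProduct, mulVec_smul,
    dotProduct_smul, smul_eq_mul] at h0
  have : T' = Real.exp (level P r (x t)) * relDecay n lam P z := by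
    rw [relDecay, ← mul_div_assoc, eq_div_iff hzQ.ne']
    linear_combination h0 - T' * a1 - Real.exp (level P r (x t)) * a2
  rw [← this]
  exact hd

/-- The projection of a classical solution on the ellipsoid. -/
theorem hasDerivAt_sphereProj_comp [NeZero n] {lam s : ℝ} (hL : IsLMISolution n lam P)
    (hr : 0 < r) {x : ℝ → Fin n → ℝ} {t : ℝ}
    (hx : HasDerivAt x (closedLoop n lam P s r (x t)) t) (hx0 : x t ≠ 0) :
    HasDerivAt (fun t => sphereProj P r (x t))
      (Real.exp (level P r (x t)) •
        (closedLoopMatrix n lam *ᵥ sphereProj P r (x t) +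
          relDecay n lam P (sphereProj P r (x t)) • (dilGen n *ᵥ sphereProj P r (x t)))) t := by
  have hd := hasDerivAt_level_comp hL hr hx hx0
  have hz := hasDerivAt_dil_mulVec hd hx
  rw [dil_level_mulVec_closedLoop hL.2.2 hL.2.1 hr] at hz
  convert! hz using 1
  rw [smul_add, smul_smul, add_comm]
  rfl

theorem hasDerivAt_gauge_comp [NeZero n] {lam s : ℝ} (hL : IsLMISolution n lam P)
    (hr : 0 < r) {x : ℝ → Fin n → ℝ} {t : ℝ}
    (hx : HasDerivAt x (closedLoop n lam P s r (x t)) t) (hx0 : x t ≠ 0) :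
    HasDerivAt (fun t => gauge P r (x t)) (-relDecay n lam P (sphereProj P r (x t))) t := by
  have hd := (hasDerivAt_level_comp hL hr hx hx0).neg.exp
  have h1 : HasDerivAt (fun t => Real.exp (-level P r (x t)))
      (-relDecay n lam P (sphereProj P r (x t))) t := by
    convert! hd using 1
    rw [mul_neg, ← mul_assoc, Pi.neg_apply, ← Real.exp_add]
    simp
  refine h1.congr_of_eventuallyEq ?_
  filter_upwards [hx.continuousAt.eventually_ne hx0] with u hu
  exact gauge_of_ne hu

end Feedback

/-! ### The Filippov regularization -/

/-- At a point of continuity the Filippov regularization is at most the value of the field. -/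
theorem eq_of_mem_filippovMap {n : ℕ} {f : (Fin n → ℝ) → (Fin n → ℝ)} {x v : Fin n → ℝ}
    (hf : ContinuousAt f x) (hv : v ∈ filippovMap f x) : v = f x := by
  refine eq_of_forall_dist_le fun ε hε => ?_
  obtain ⟨δ, hδ, hball⟩ := Metric.continuousAt_iff.mp hf ε hε
  have h := hv δ hδ ∅ measure_empty
  have hsub : f '' (Metric.ball x δ \ ∅) ⊆ Metric.closedBall (f x) ε := by
    rintro _ ⟨y, hy, rfl⟩
    exact (hball hy.1).le
  exact closure_minimal (convexHull_min hsub (convex_closedBall _ _)) Metric.isClosed_closedBall h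

theorem apply_mem_filippovMap {n : ℕ} {f : (Fin n → ℝ) → (Fin n → ℝ)} {x : Fin n → ℝ}
    (hf : ContinuousAt f x) : f x ∈ filippovMap f x := by
  intro δ hδ N hN
  have hd : Dense Nᶜ := by
    rw [← interior_eq_empty_iff_dense_compl]
    exact Measure.interior_eq_empty_of_null hN
  have hx : x ∈ closure (Metric.ball x δ \ N) :=
    hd.open_subset_closure_inter Metric.isOpen_ball (Metric.mem_ball_self hδ)
  exact closure_mono (subset_convexHull ℝ _)
    (hf.continuousWithinAt.mem_closure_image hx)

/-- For an odd vector field the origin is an equilibrium of the Filippov inclusion: `0` is the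
midpoint of the values at two opposite points, both of which avoid a given null set. -/
theorem zero_mem_filippovMap_of_odd {n : ℕ} {f : (Fin n → ℝ) → (Fin n → ℝ)}
    (hf : ∀ x, f (-x) = -f x) : (0 : Fin n → ℝ) ∈ filippovMap f 0 := by
  intro δ hδ N hN
  have hN' : volume (N ∪ -N) = 0 := measure_union_null hN (by rw [Measure.measure_neg, hN])
  have hd : Dense (N ∪ -N)ᶜ := by
    rw [← interior_eq_empty_iff_dense_compl]
    exact Measure.interior_eq_empty_of_null hN'
  obtain ⟨x, hx, hxN⟩ := hd.inter_open_nonempty (Metric.ball 0 δ) Metric.isOpen_ball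
    ⟨0, Metric.mem_ball_self hδ⟩
  rw [Set.mem_compl_iff, Set.mem_union, not_or] at hxN
  refine subset_closure ?_
  have h1 : f x ∈ f '' (Metric.ball 0 δ \ N) := ⟨x, ⟨hx, hxN.1⟩, rfl⟩
  have h2 : f (-x) ∈ f '' (Metric.ball 0 δ \ N) :=
    ⟨-x, ⟨by simpa using hx, fun h => hxN.2 (by simpa using h)⟩, rfl⟩
  have h3 := (convex_convexHull ℝ (f '' (Metric.ball 0 δ \ N)))
    (subset_convexHull ℝ _ h1) (subset_convexHull ℝ _ h2)
    (by norm_num : (0 : ℝ) ≤ 1 / 2) (by norm_num : (0 : ℝ) ≤ 1 / 2) (by norm_num)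
  rw [hf, smul_neg, add_neg_cancel] at h3
  exact h3

theorem IsFilippovSolution.continuousOn {n : ℕ} {f : (Fin n → ℝ) → (Fin n → ℝ)}
    {x : ℝ → Fin n → ℝ} (hx : IsFilippovSolution f x) {b : ℝ} (hb : 0 ≤ b) :
    ContinuousOn x (Set.Icc 0 b) := by
  have := (hx.1 b hb).continuousOn
  rwa [Set.uIcc_of_le hb] at this

/-- A Filippov solution is a classical solution while it stays in the open set where the field is
continuous. -/
theorem IsFilippovSolution.hasDerivAt {n : ℕ} {f : (Fin n → ℝ) → (Fin n → ℝ)}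
    {x : ℝ → Fin n → ℝ} (hx : IsFilippovSolution f x) {U : Set (Fin n → ℝ)} (hU : IsOpen U)
    (hf : ∀ y ∈ U, ContinuousAt f y) {t : ℝ} (ht : 0 < t) (hxt : x t ∈ U) :
    HasDerivAt x (f (x t)) t := by
  have hxc : ContinuousAt x t :=
    (hx.continuousOn (by linarith : (0 : ℝ) ≤ t + 1)).continuousAt
      (Icc_mem_nhds ht (by linarith))
  have hev : ∀ᶠ u in 𝓝 t, 0 < u ∧ x u ∈ U :=
    (eventually_gt_nhds ht).and (hxc.eventually (hU.mem_nhds hxt))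
  obtain ⟨ε, hε, hball⟩ := Metric.nhds_basis_closedBall.eventually_iff.mp hev
  rw [Real.closedBall_eq_Icc] at hball
  set a := t - ε
  set b := t + ε
  have hab : a ≤ b := by simp only [a, b]; linarith
  have ha : 0 < a := (hball ⟨le_rfl, hab⟩).1
  have hxab : ContinuousOn x (Set.Icc a b) :=
    (hx.continuousOn (ha.le.trans hab)).mono (Set.Icc_subset_Icc_left ha.le)
  have hg : ContinuousOn (fun u => f (x u)) (Set.Icc a b) := fun u hu =>
    (hf _ (hball hu).2).comp_continuousWithinAt (hxab u hu)
  let g : ℝ → Fin n → ℝ := Set.IccExtend hab ((Set.Icc a b).domRestrict fun u => f (x u))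
  have hgc : Continuous g := (continuousOn_iff_continuous_domRestrict.mp hg).Icc_extend'
  have hgx : ∀ u ∈ Set.Icc a b, g u = f (x u) := fun u hu => by
    simp only [g, Set.IccExtend_of_mem hab _ hu, Set.domRestrict_apply]
  let G : ℝ → Fin n → ℝ := fun u => ∫ w in a..u, g w
  have hG : ∀ u, HasDerivAt G (g u) u := fun u => (hgc.integral_hasStrictDerivAt a u).hasDerivAt
  have hG1 : ContDiff ℝ 1 G := by
    rw [contDiff_one_iff_deriv]
    refine ⟨fun u => (hG u).differentiableAt, ?_⟩
    rwa [show deriv G = g from funext fun u => (hG u).deriv]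
  have hxAC : AbsolutelyContinuousOnInterval x a b := by
    refine (hx.1 b (ha.le.trans hab)).mono ?_
    rw [Set.uIcc_of_le hab, Set.uIcc_of_le (ha.le.trans hab)]
    exact Set.Icc_subset_Icc_left ha.le
  have hGAC : AbsolutelyContinuousOnInterval G a b :=
    hG1.contDiffOn.absolutelyContinuousOnInterval
  obtain ⟨C, hC⟩ := (hxAC.sub hGAC).const_of_ae_hasDerivAt_zero (by
    filter_upwards [hx.2] with u hu huab
    rw [Set.uIcc_of_le hab] at huab
    obtain ⟨v, hv, hd⟩ := hu (hball huab).1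
    have hvf := eq_of_mem_filippovMap (hf _ (hball huab).2) hv
    have := hd.sub (hG u)
    rwa [hgx u huab, hvf, sub_self] at this)
  rw [Set.uIcc_of_le hab] at hC
  have htab : t ∈ Set.Icc a b := ⟨by simp only [a]; linarith, by simp only [b]; linarith⟩
  rw [← hgx t htab]
  refine ((hG t).const_add C).congr_of_eventuallyEq ?_
  filter_upwards [Icc_mem_nhds (show a < t by simp only [a]; linarith)
    (show t < b by simp only [b]; linarith)] with u hu
  have := hC u hu
  rw [Pi.sub_apply, sub_eq_iff_eq_add] at this
  exact this

/-! ### Differential inequalities and Metzler systems -/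

/-- A function that decreases at rate at least `ρ` while it is positive, and so cannot become
positive again. -/
theorem le_max_sub_mul_of_hasDerivAt_le {W W' : ℝ → ℝ} {a b ρ : ℝ} (hab : a ≤ b) (hρ : 0 ≤ ρ)
    (hW : ContinuousOn W (Set.Icc a b))
    (hd : ∀ t ∈ Set.Ioo a b, 0 < W t → HasDerivAt W (W' t) t ∧ W' t ≤ -ρ) :
    W b ≤ max (W a - ρ * (b - a)) 0 := by
  by_contra! hcon
  rw [max_lt_iff] at hcon
  have key : ∀ c ∈ Set.Icc a b, (∀ t ∈ Set.Ioo c b, 0 < W t) → W b - W c ≤ -ρ * (b - c) := by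
    intro c hc hpos
    have hsub : ∀ t ∈ Set.Ioo c b, t ∈ Set.Ioo a b := fun t ht => ⟨hc.1.trans_lt ht.1, ht.2⟩
    refine (convex_Icc c b).image_sub_le_mul_sub_of_deriv_le (C := -ρ)
      (hW.mono (Set.Icc_subset_Icc_left hc.1)) ?_ ?_ c ⟨le_rfl, hc.2⟩ b ⟨hc.2, le_rfl⟩ hc.2
    · rw [interior_Icc]
      intro t ht
      exact (hd t (hsub t ht) (hpos t ht)).1.differentiableAt.differentiableWithinAt
    · rw [interior_Icc]
      intro t ht
      have := hd t (hsub t ht) (hpos t ht)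
      rw [this.1.deriv]
      exact this.2
  -- the last time at which `W` is not positive, if there is one
  let S := Set.Icc a b ∩ W ⁻¹' Set.Iic 0
  have hS : IsCompact S :=
    (isCompact_Icc).of_isClosed_subset (hW.preimage_isClosed_of_isClosed isClosed_Icc isClosed_Iic)
      Set.inter_subset_left
  rcases S.eq_empty_or_nonempty with hSe | hSn
  · have := key a ⟨le_rfl, hab⟩ fun t ht => by
      by_contra! h
      have : t ∈ S := ⟨⟨ht.1.le, ht.2.le⟩, h⟩
      rw [hSe] at this
      exact this
    linarith
  · obtain ⟨c, hcS, hc⟩ := hS.exists_isGreatest hSn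
    have := key c hcS.1 fun t ht => by
      by_contra! h
      exact absurd (hc ⟨⟨hcS.1.1.trans ht.1.le, ht.2.le⟩, h⟩) (not_le.mpr ht.1)
    have h1 : W c ≤ 0 := hcS.2
    have h2 : 0 ≤ ρ * (b - c) := mul_nonneg hρ (sub_nonneg.mpr hcS.1.2)
    linarith

theorem hasDerivAt_min_zero_sq (x : ℝ) : HasDerivAt (fun x : ℝ => min x 0 ^ 2) (2 * min x 0) x := by
  rcases lt_trichotomy x 0 with hx | rfl | hx
  · rw [min_eq_left hx.le]
    have h : HasDerivAt (fun x : ℝ => x ^ 2) (2 * x) x := by simpa using hasDerivAt_pow 2 x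
    refine h.congr_of_eventuallyEq ?_
    filter_upwards [eventually_lt_nhds hx] with y hy
    rw [min_eq_left hy.le]
  · rw [min_self, mul_zero, hasDerivAt_iff_isLittleO_nhds_zero]
    simp only [zero_add, min_self, smul_zero, sub_zero, ne_eq, OfNat.ofNat_ne_zero,
      not_false_eq_true, zero_pow]
    have h1 : (fun h : ℝ => min h 0 ^ 2) =O[𝓝 0] fun h : ℝ => h ^ 2 := by
      refine Asymptotics.IsBigO.of_bound 1 (Eventually.of_forall fun h => ?_)
      rw [one_mul, Real.norm_of_nonneg (sq_nonneg _), Real.norm_of_nonneg (sq_nonneg _)]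
      rcases le_total h 0 with h' | h'
      · rw [min_eq_left h']
      · rw [min_eq_right h']; simpa using sq_nonneg h
    exact h1.trans_isLittleO (by simpa using (Asymptotics.isLittleO_pow_id (𝕜 := ℝ) one_lt_two))
  · rw [min_eq_right hx.le, mul_zero]
    refine (hasDerivAt_const x (0 : ℝ)).congr_of_eventuallyEq ?_
    filter_upwards [eventually_gt_nhds hx] with y hy
    rw [min_eq_right hy.le]
    simp

/-- A linear system whose matrix has nonnegative off-diagonal entries leaves the nonnegative orthant
invariant: by Grönwall, the sum of the squares of the negative parts stays zero. -/
theorem nonneg_of_hasDerivAt_metzler {n : ℕ} {M : ℝ → Matrix (Fin n) (Fin n) ℝ}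
    {φ : ℝ → Fin n → ℝ} {a b : ℝ} (hab : a ≤ b)
    (hM : ∀ i j, ContinuousOn (fun t => M t i j) (Set.Icc a b))
    (hoff : ∀ t ∈ Set.Ioo a b, ∀ i j, i ≠ j → 0 ≤ M t i j)
    (hφ : ContinuousOn φ (Set.Icc a b))
    (hd : ∀ t ∈ Set.Ioo a b, HasDerivAt φ (M t *ᵥ φ t) t) (ha : ∀ i, 0 ≤ φ a i) :
    ∀ i, 0 ≤ φ b i := by
  obtain ⟨C, hC⟩ : ∃ C, ∀ t ∈ Set.Icc a b, ∀ i j, |M t i j| ≤ C := by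
    have hc : ContinuousOn (fun t => (fun i j => M t i j : Fin n → Fin n → ℝ)) (Set.Icc a b) :=
      continuousOn_pi.mpr fun i => continuousOn_pi.mpr fun j => hM i j
    obtain ⟨C, hC⟩ := isCompact_Icc.exists_bound_of_continuousOn hc
    refine ⟨C, fun t ht i j => ?_⟩
    exact (norm_le_pi_norm (fun j => M t i j) j).trans
      ((norm_le_pi_norm (fun i j => M t i j : Fin n → Fin n → ℝ) i).trans (hC t ht))
  let N : ℝ → ℝ := fun t => ∑ i, min (φ t i) 0 ^ 2
  have hNc : ContinuousOn N (Set.Icc a b) := by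
    refine continuousOn_finsetSum _ fun i _ => ?_
    exact (show Continuous fun y : ℝ => min y 0 ^ 2 by fun_prop).comp_continuousOn
      (continuousOn_pi.mp hφ i)
  have hN0 : ∀ t, 0 ≤ N t := fun t => Finset.sum_nonneg fun i _ => sq_nonneg _
  have hNd : ∀ t ∈ Set.Ioo a b,
      HasDerivAt N (∑ i, 2 * min (φ t i) 0 * (M t *ᵥ φ t) i) t := by
    intro t ht
    have h := hasDerivAt_pi.mp (hd t ht)
    refine HasDerivAt.fun_sum fun i _ => ?_
    exact HasDerivAt.comp (h₂ := fun y : ℝ => min y 0 ^ 2) t (hasDerivAt_min_zero_sq (φ t i)) (h i)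
  have hbound : ∀ t ∈ Set.Ioo a b,
      ∑ i, 2 * min (φ t i) 0 * (M t *ᵥ φ t) i ≤ 2 * n * C * N t := by
    intro t ht
    have hterm : ∀ i j, 2 * min (φ t i) 0 * (M t i j * φ t j) ≤
        C * (min (φ t i) 0 ^ 2 + min (φ t j) 0 ^ 2) := by
      intro i j
      have hCij := hC t ⟨ht.1.le, ht.2.le⟩ i j
      have hi : min (φ t i) 0 ≤ 0 := min_le_right _ _
      have hj : min (φ t j) 0 ≤ 0 := min_le_right _ _
      have h1 : 2 * min (φ t i) 0 * (M t i j * φ t j) ≤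
          2 * min (φ t i) 0 * (M t i j * min (φ t j) 0) := by
        rcases eq_or_ne i j with rfl | hij
        · rcases le_total (φ t i) 0 with h | h
          · rw [min_eq_left h]
          · rw [min_eq_right h]; simp
        · have h2 : M t i j * min (φ t j) 0 ≤ M t i j * φ t j :=
            mul_le_mul_of_nonneg_left (min_le_left _ _) (hoff t ht i j hij)
          exact mul_le_mul_of_nonpos_left h2 (by linarith)
      have h3 : 0 ≤ min (φ t i) 0 * min (φ t j) 0 := mul_nonneg_of_nonpos_of_nonpos hi hj
      have h4 := mul_le_mul_of_nonneg_right ((le_abs_self _).trans hCij) h3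
      have hC0 : 0 ≤ C := (abs_nonneg _).trans hCij
      nlinarith [mul_nonneg hC0 (sq_nonneg (min (φ t i) 0 - min (φ t j) 0))]
    calc ∑ i, 2 * min (φ t i) 0 * (M t *ᵥ φ t) i
        = ∑ i, ∑ j, 2 * min (φ t i) 0 * (M t i j * φ t j) := by
          simp only [mulVec, dotProduct, Finset.mul_sum]
      _ ≤ ∑ i, ∑ j, C * (min (φ t i) 0 ^ 2 + min (φ t j) 0 ^ 2) :=
          Finset.sum_le_sum fun i _ => Finset.sum_le_sum fun j _ => hterm i j
      _ = 2 * n * C * N t := by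
          simp only [← Finset.mul_sum, Finset.sum_add_distrib, Finset.sum_const, Finset.card_univ,
            Fintype.card_fin, nsmul_eq_mul, N]
          ring
  set K := 2 * n * C
  have hEd : ∀ t ∈ Set.Ioo a b, HasDerivAt (fun t => N t * Real.exp (-K * t))
      ((∑ i, 2 * min (φ t i) 0 * (M t *ᵥ φ t) i) * Real.exp (-K * t) +
        N t * (Real.exp (-K * t) * -K)) t := by
    intro t ht
    have h2 : HasDerivAt (fun t => Real.exp (-K * t)) (Real.exp (-K * t) * -K) t := by
      simpa using ((hasDerivAt_id' t).const_mul (-K)).exp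
    exact (hNd t ht).mul h2
  have hdecr := (convex_Icc a b).image_sub_le_mul_sub_of_deriv_le (C := 0)
    (f := fun t => N t * Real.exp (-K * t)) (hNc.mul (by fun_prop)) (by
      rw [interior_Icc]
      exact fun t ht => (hEd t ht).differentiableAt.differentiableWithinAt) (by
      rw [interior_Icc]
      intro t ht
      rw [(hEd t ht).deriv]
      have := mul_le_mul_of_nonneg_right (hbound t ht) (Real.exp_nonneg (-K * t))
      linarith) a ⟨le_rfl, hab⟩ b ⟨hab, le_rfl⟩ hab
  have hNa : N a = 0 := Finset.sum_eq_zero fun i _ => by rw [min_eq_right (ha i)]; simp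
  rw [hNa, zero_mul, sub_zero, zero_mul] at hdecr
  have hNb : N b = 0 :=
    le_antisymm (nonpos_of_mul_nonpos_left hdecr (Real.exp_pos _)) (hN0 b)
  intro i
  have := (Finset.sum_eq_zero_iff_of_nonneg fun i _ => sq_nonneg (min (φ b i) 0)).mp hNb i
    (Finset.mem_univ i)
  rw [sq_eq_zero_iff] at this
  exact min_eq_right_iff.mp this

/-! ### Finite-time stability -/

section Solutions

variable {n : ℕ} [NeZero n] {lam s r : ℝ} {P : Matrix (Fin n) (Fin n) ℝ} {x : ℝ → Fin n → ℝ}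

theorem hasDerivAt_of_ne_zero (hL : IsLMISolution n lam P) (hr : 0 < r)
    (hx : IsFilippovSolution (closedLoop n lam P s r) x) {t : ℝ} (ht : 0 < t) (hxt : x t ≠ 0) :
    HasDerivAt x (closedLoop n lam P s r (x t)) t :=
  hx.hasDerivAt isOpen_ne (fun _ hy => continuousAt_closedLoop hL.2.2 hL.2.1 hr s hy) ht hxt

/-- The gauge decreases along every solution at rate at least `ρ` until it vanishes. -/
theorem gauge_le_max (hL : IsLMISolution n lam P) (hr : 0 < r)
    (hx : IsFilippovSolution (closedLoop n lam P s r) x) {a b : ℝ} (ha : 0 ≤ a) (hab : a ≤ b) :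
    gauge P r (x b) ≤ max (gauge P r (x a) - decayRate n lam P * (b - a)) 0 := by
  refine le_max_sub_mul_of_hasDerivAt_le (W := fun t => gauge P r (x t))
    (W' := fun t => -relDecay n lam P (sphereProj P r (x t))) hab (decayRate_spec hL).1.le ?_ ?_
  · exact (continuous_gauge hL.2.2 hL.2.1 hr).comp_continuousOn
      ((hx.continuousOn (ha.trans hab)).mono (Set.Icc_subset_Icc_left ha))
  · intro t ht hpos
    have hxt := gauge_pos_iff.mp hpos
    exact ⟨hasDerivAt_gauge_comp hL hr
      (hasDerivAt_of_ne_zero hL hr hx (ha.trans_lt ht.1) hxt) hxt,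
      neg_le_neg (decayRate_le_relDecay hL (sphereProj_ne_zero hxt))⟩

theorem eq_zero_of_gauge_le (hL : IsLMISolution n lam P) (hr : 0 < r)
    (hx : IsFilippovSolution (closedLoop n lam P s r) x) {t : ℝ} (ht0 : 0 ≤ t)
    (ht : gauge P r (x 0) ≤ decayRate n lam P * t) : x t = 0 := by
  by_contra h
  have h1 := gauge_le_max hL hr hx le_rfl ht0
  rw [max_eq_right (by linarith)] at h1
  exact absurd (gauge_pos_iff.mpr h) (not_lt.mpr h1)

theorem isFiniteTimeStable_closedLoop (hL : IsLMISolution n lam P) (hr : 0 < r) :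
    IsFiniteTimeStable (closedLoop n lam P s r) := by
  have hρ := (decayRate_spec hL).1
  have hc := continuous_gauge hL.2.2 hL.2.1 hr
  refine ⟨fun ε hε => ?_, fun y => gauge P r y / decayRate n lam P, fun y => ?_, fun y => ?_,
    fun x hx t ht => ?_⟩
  · obtain ⟨η, hη, hsmall⟩ := exists_gauge_lt_imp_norm_lt hL.2.2 hL.2.1 hr hε
    have hev : ∀ᶠ y in 𝓝 (0 : Fin n → ℝ), gauge P r y < η :=
      hc.continuousAt.eventually_lt_const (by rwa [gauge_zero])
    obtain ⟨δ, hδ, hball⟩ := Metric.eventually_nhds_iff.mp hev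
    refine ⟨δ, hδ, fun x hx hx0 t ht => hsmall _ ?_⟩
    refine (gauge_le_max hL hr hx le_rfl ht).trans_lt (max_lt ?_ hη)
    have h1 := hball (by rwa [dist_zero_right] : dist (x 0) 0 < δ)
    have h2 : 0 ≤ decayRate n lam P * (t - 0) := mul_nonneg hρ.le (by linarith)
    linarith
  · exact div_nonneg (gauge_nonneg y) hρ.le
  · refine ⟨gauge P r y / decayRate n lam P + 1, ?_⟩
    have := (hc.div_const (decayRate n lam P)).continuousAt (x := y)
    filter_upwards [this.eventually_lt_const (lt_add_one _)] with z hz using hz.le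
  · have h0 : 0 ≤ t := (div_nonneg (gauge_nonneg _) hρ.le).trans ht
    rw [div_le_iff₀' hρ] at ht
    exact eq_zero_of_gauge_le hL hr hx h0 ht

/-- The settling time on the ball of radius `r`: there the gauge is at most `e^{-s} ≤ ρ T`. -/
theorem eq_zero_of_weightedNorm_le (hL : IsLMISolution n lam P) (hr : 0 < r) {T : ℝ} (hT : 0 < T)
    (hs : Real.log (max (1 / (decayRate n lam P * T)) 1) ≤ s)
    (hx : IsFilippovSolution (closedLoop n lam P s r) x)
    (hx0 : weightedNorm (scaledWeight P s) (x 0) ≤ r) {t : ℝ} (ht : T ≤ t) : x t = 0 := by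
  have hρ := (decayRate_spec hL).1
  refine eq_zero_of_gauge_le hL hr hx (hT.le.trans ht) ?_
  refine le_trans ?_ (mul_le_mul_of_nonneg_left ht hρ.le)
  rcases eq_or_ne (x 0) 0 with h0 | h0
  · rw [h0, gauge_zero]; positivity
  · have h1 : s ≤ level P r (x 0) := by
      refine le_level_of_quadForm_le hL.2.2 hL.2.1 hr h0 ?_
      rw [quadForm_dil_eq_sq_weightedNorm hL.2.2]
      exact pow_le_pow_left₀ (Real.sqrt_nonneg _) hx0 2
    rw [gauge_of_ne h0]
    have h2 : 1 / (decayRate n lam P * T) ≤ Real.exp s := by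
      rw [Real.log_le_iff_le_exp (by positivity)] at hs
      exact (le_max_left _ _).trans hs
    calc Real.exp (-level P r (x 0)) ≤ Real.exp (-s) := Real.exp_le_exp.mpr (neg_le_neg h1)
      _ = 1 / Real.exp s := by rw [Real.exp_neg, one_div]
      _ ≤ decayRate n lam P * T := by
        rw [div_le_iff₀ (by positivity)] at h2 ⊢
        linarith

end Solutions

/-! ### Invariance of the cones -/

theorem barrierGen_nonneg {n : ℕ} {lam : ℝ} (hlam : 0 ≤ lam) {i j : Fin n} (hij : i ≠ j) :
    0 ≤ barrierGen n lam i j := by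
  simp only [barrierGen, of_apply, if_neg hij]
  split_ifs <;> positivity

theorem chainMatrix_nonneg {n : ℕ} (i j : Fin n) : 0 ≤ chainMatrix n i j := by
  simp only [chainMatrix, of_apply]
  split_ifs <;> norm_num

section Cone

variable {n : ℕ} [NeZero n] {lam s r : ℝ} {P : Matrix (Fin n) (Fin n) ℝ} {x : ℝ → Fin n → ℝ}

/-- Along a solution that does not vanish, the barrier functions of the projected state solve a
linear system with nonnegative off-diagonal entries. -/
theorem isPositivelyInvariant_homCone (hlam : 0 < lam) (hL : IsLMISolution n lam P) (hr : 0 < r) :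
    IsPositivelyInvariant (closedLoop n lam P s r) (homCone n lam P s r) := by
  intro x hx hx0 b hb
  have ⟨_, hQ, hP⟩ := hL
  rw [mem_homCone_iff hP hQ hr] at hx0 ⊢
  rcases eq_or_ne (x b) 0 with hxb | hxb
  · intro i
    rw [hxb, sphereProj_zero, dotProduct_zero]
  have hρ := (decayRate_spec hL).1
  have hne : ∀ t ∈ Set.Icc 0 b, x t ≠ 0 := by
    intro t ht h0
    have h1 := gauge_le_max hL hr hx ht.1 ht.2
    have h2 : 0 ≤ decayRate n lam P * (b - t) := mul_nonneg hρ.le (by linarith [ht.2])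
    rw [h0, gauge_zero, max_eq_right (by linarith)] at h1
    exact absurd (gauge_pos_iff.mpr hxb) (not_lt.mpr h1)
  have hxc := hx.continuousOn hb
  have hlc : ContinuousOn (fun t => level P r (x t)) (Set.Icc 0 b) := fun t ht =>
    (differentiableAt_level hP hQ hr (hne t ht)).continuousAt.comp_continuousWithinAt (hxc t ht)
  have hzc : ContinuousOn (fun t => sphereProj P r (x t)) (Set.Icc 0 b) := fun t ht =>
    (continuousAt_sphereProj hP hQ hr (hne t ht)).comp_continuousWithinAt (hxc t ht)
  have hkc : ContinuousOn (fun t => relDecay n lam P (sphereProj P r (x t))) (Set.Icc 0 b) :=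
    fun t ht => (continuousAt_relDecay hL (sphereProj_ne_zero (hne t ht))).comp_continuousWithinAt
      (f := fun t => sphereProj P r (x t)) (hzc t ht)
  let M : ℝ → Matrix (Fin n) (Fin n) ℝ := fun t => Real.exp (level P r (x t)) •
    ((chainMatrix n - lam • (1 : Matrix (Fin n) (Fin n) ℝ)) +
      relDecay n lam P (sphereProj P r (x t)) • barrierGen n lam)
  refine nonneg_of_hasDerivAt_metzler (M := M)
    (φ := fun t => barrierMatrix n lam *ᵥ sphereProj P r (x t)) hb ?_ ?_ ?_ ?_ hx0
  · intro i j
    simp only [M, Matrix.smul_apply, Matrix.add_apply, smul_eq_mul]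
    exact hlc.rexp.mul (continuousOn_const.add (hkc.mul continuousOn_const))
  · intro t ht i j hij
    have hz := sphereProj_ne_zero (P := P) (r := r) (hne t ⟨ht.1.le, ht.2.le⟩)
    have hk := hρ.le.trans (decayRate_le_relDecay hL hz)
    have h1 := barrierGen_nonneg hlam.le hij
    have h2 := chainMatrix_nonneg i j
    simp only [M, Matrix.smul_apply, Matrix.add_apply, Matrix.sub_apply, smul_eq_mul,
      one_apply_ne hij, mul_zero, sub_zero]
    positivity
  · exact (show Continuous fun y : Fin n → ℝ => barrierMatrix n lam *ᵥ y by
      fun_prop).comp_continuousOn hzc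
  · intro t ht
    have hxt := hne t ⟨ht.1.le, ht.2.le⟩
    have h := hasDerivAt_mulVec (barrierMatrix n lam) (hasDerivAt_sphereProj_comp hL hr
      (hasDerivAt_of_ne_zero hL hr hx ht.1 hxt) hxt)
    convert! h using 1
    simp only [mulVec_smul, mulVec_add, mulVec_mulVec, barrierMatrix_mul_closedLoopMatrix,
      barrierMatrix_mul_dilGen, M, Matrix.smul_mul, Matrix.add_mul, smul_mulVec, add_mulVec]

/-- Dilating by a nonnegative exponent preserves the linear cone. -/
theorem dil_mulVec_mem_linCone (hlam : 0 < lam) {x₀ : Fin n → ℝ} (hx₀ : x₀ ∈ linCone n lam)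
    {τ : ℝ} (hτ : 0 ≤ τ) : dil n τ *ᵥ x₀ ∈ linCone n lam := by
  have hd : ∀ t, HasDerivAt (fun t => dil n t *ᵥ x₀) (dilGen n *ᵥ (dil n t *ᵥ x₀)) t := by
    intro t
    simpa using hasDerivAt_dil_mulVec (hasDerivAt_id' t) (hasDerivAt_const t x₀)
  have hd' : ∀ t, HasDerivAt (fun t => barrierMatrix n lam *ᵥ (dil n t *ᵥ x₀))
      (barrierGen n lam *ᵥ (barrierMatrix n lam *ᵥ (dil n t *ᵥ x₀))) t := by
    intro t
    have h := hasDerivAt_mulVec (barrierMatrix n lam) (hd t)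
    rwa [mulVec_mulVec, barrierMatrix_mul_dilGen, ← mulVec_mulVec] at h
  refine nonneg_of_hasDerivAt_metzler (M := fun _ => barrierGen n lam)
    (φ := fun t => barrierMatrix n lam *ᵥ (dil n t *ᵥ x₀)) hτ (fun i j => continuousOn_const)
    (fun t _ i j hij => barrierGen_nonneg hlam.le hij)
    (fun t _ => (hd' t).continuousAt.continuousWithinAt) (fun t _ => hd' t) ?_
  intro i
  rw [dil_zero, one_mulVec]
  exact hx₀ i

theorem mem_homCone_of_mem_linCone (hlam : 0 < lam) (hL : IsLMISolution n lam P) (hr : 0 < r)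
    {x₀ : Fin n → ℝ} (hx₀ : x₀ ∈ linCone n lam)
    (hle : homNorm (scaledWeight P s) (r⁻¹ • x₀) ≤ Real.exp s) : x₀ ∈ homCone n lam P s r := by
  have ⟨_, hQ, hP⟩ := hL
  rw [mem_homCone_iff hP hQ hr]
  rcases eq_or_ne x₀ 0 with rfl | h0
  · intro i
    rw [sphereProj_zero, dotProduct_zero]
  · rw [homNorm_eq_exp hP hQ hr s h0, Real.exp_le_exp] at hle
    exact dil_mulVec_mem_linCone hlam hx₀ (by linarith)

theorem barrierRow_zero_dotProduct (x : Fin n → ℝ) : barrierRow n lam 0 ⬝ᵥ x = -x 0 := by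
  rw [barrierRow, Fin.val_zero, chainRow_zero, neg_dotProduct, single_dotProduct, one_mul]

theorem linCone_subset : linCone n lam ⊆ safeHalfSpace n := by
  intro x hx
  have := hx 0
  rw [barrierRow_zero_dotProduct] at this
  exact neg_nonneg.mp this

theorem homCone_subset (hL : IsLMISolution n lam P) (hr : 0 < r) :
    homCone n lam P s r ⊆ safeHalfSpace n := by
  intro x hx
  have := (mem_homCone_iff hL.2.2 hL.2.1 hr s x).mp hx 0
  rw [barrierRow_zero_dotProduct, sphereProj, dil_mulVec_apply, ← mul_neg] at this
  exact neg_nonneg.mp (nonneg_of_mul_nonneg_right this (Real.exp_pos _))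

end Cone

/-! ### Existence of solutions -/

/-- A bounded Lipschitz autonomous vector field has global integral curves. -/
theorem exists_global_integralCurve {E : Type*} [NormedAddCommGroup E] [NormedSpace ℝ E]
    [CompleteSpace E] {F : E → E} {K L : NNReal} (hF : LipschitzWith K F) (hL : ∀ x, ‖F x‖ ≤ L)
    (z₀ : E) : ∃ z : ℝ → E, z 0 = z₀ ∧ ∀ t, HasDerivAt z (F (z t)) t := by
  have hloc : ∀ N : ℕ, ∃ α : ℝ → E, α 0 = z₀ ∧
      ∀ t ∈ Set.Ioo (-(N + 1 : ℝ)) (N + 1), HasDerivAt α (F (α t)) t := by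
    intro N
    have hN : (0 : ℝ) ≤ N + 1 := by positivity
    have hPL : IsPicardLindelof (fun _ => F) (tmin := -(N + 1 : ℝ)) (tmax := N + 1)
        ⟨0, neg_nonpos.mpr hN, hN⟩ z₀ (L * (N + 1)) 0 L K :=
      .of_time_independent (fun x _ => hL x) hF.lipschitzOnWith (by simp)
    obtain ⟨α, h0, hα⟩ := hPL.exists_eq_forall_mem_Icc_hasDerivWithinAt₀
    exact ⟨α, h0, fun t ht => (hα t ⟨ht.1.le, ht.2.le⟩).hasDerivAt (Icc_mem_nhds ht.1 ht.2)⟩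
  choose α hα0 hα using hloc
  -- the curves on the intervals `(-(N + 1), N + 1)` agree where they overlap
  have hagree : ∀ N M : ℕ, N ≤ M → Set.EqOn (α N) (α M) (Set.Ioo (-(N + 1 : ℝ)) (N + 1)) := by
    intro N M hNM
    have hNM' : (N : ℝ) ≤ M := by exact_mod_cast hNM
    have hN : (0 : ℝ) ≤ N := by positivity
    refine ODE_solution_unique_of_mem_Ioo (v := fun _ => F) (s := fun _ => Set.univ) (t₀ := 0)
      (fun _ _ => hF.lipschitzOnWith) ⟨by linarith, by linarith⟩ (fun t ht => ⟨hα N t ht, trivial⟩)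
      (fun t ht => ⟨hα M t ⟨by linarith [ht.1], by linarith [ht.2]⟩, trivial⟩)
      ((hα0 N).trans (hα0 M).symm)
  let z : ℝ → E := fun t => α ⌈|t|⌉₊ t
  have hz : ∀ (N : ℕ) (t : ℝ), t ∈ Set.Ioo (-(N + 1 : ℝ)) (N + 1) → z t = α N t := by
    intro N t ht
    have h1 : |t| ≤ ⌈|t|⌉₊ := Nat.le_ceil _
    have h2 : t ∈ Set.Ioo (-((⌈|t|⌉₊ : ℕ) + 1 : ℝ)) ((⌈|t|⌉₊ : ℕ) + 1) := by
      have := abs_le.mp h1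
      constructor <;> linarith [this.1, this.2]
    rcases le_total ⌈|t|⌉₊ N with h | h
    · exact hagree _ _ h h2
    · exact (hagree _ _ h ht).symm
  refine ⟨z, by rw [hz 0 0 (by simp), hα0], fun t => ?_⟩
  have h1 : |t| ≤ ⌈|t|⌉₊ := Nat.le_ceil _
  have h2 : t ∈ Set.Ioo (-((⌈|t|⌉₊ : ℕ) + 1 : ℝ)) ((⌈|t|⌉₊ : ℕ) + 1) := by
    have := abs_le.mp h1
    constructor <;> linarith [this.1, this.2]
  rw [hz _ t h2]
  refine (hα _ t h2).congr_of_eventuallyEq ?_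
  filter_upwards [isOpen_Ioo.mem_nhds h2] with u hu using hz _ u hu

/-- Change of clock: a speed `g` between two positive bounds, continuous off `0`, is the reciprocal
of the speed of a homeomorphism `h` of the line fixing `0`. -/
theorem exists_clock {g : ℝ → ℝ} {c C : ℝ} (hc : 0 < c) (hgm : Measurable g)
    (hg : ∀ w, c ≤ g w ∧ g w ≤ C) (hgc : ∀ w, w ≠ 0 → ContinuousAt g w) :
    ∃ h : ℝ → ℝ, Continuous h ∧ StrictMono h ∧ Function.Surjective h ∧ h 0 = 0 ∧
      ∀ t, h t ≠ 0 → HasDerivAt h (g (h t))⁻¹ t := by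
  have hint : ∀ a b, IntervalIntegrable g volume a b := by
    intro a b
    refine (intervalIntegrable_const (c := C)).mono_fun hgm.aestronglyMeasurable
      (Eventually.of_forall fun w => ?_)
    have := hg w
    dsimp only
    rw [Real.norm_of_nonneg (hc.le.trans this.1),
      Real.norm_of_nonneg (hc.le.trans (this.1.trans this.2))]
    exact this.2
  let S : ℝ → ℝ := fun w => ∫ u in (0 : ℝ)..w, g u
  have hsub : ∀ a b, S b - S a = ∫ u in a..b, g u := fun a b =>
    intervalIntegral.integral_interval_sub_left (hint _ _) (hint _ _)
  have hlow : ∀ a b, a ≤ b → c * (b - a) ≤ S b - S a := by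
    intro a b hab
    rw [hsub]
    have := intervalIntegral.integral_mono_on hab (intervalIntegrable_const (c := c)) (hint a b)
      (fun w _ => (hg w).1)
    rw [intervalIntegral.integral_const, smul_eq_mul] at this
    linarith
  have hmono : StrictMono S := fun a b hab => by
    have := hlow a b hab.le
    have h2 : 0 < c * (b - a) := mul_pos hc (sub_pos.mpr hab)
    linarith
  have hS0 : S 0 = 0 := intervalIntegral.integral_same
  have hcont : Continuous S := intervalIntegral.continuous_primitive hint 0
  have hsurj : Function.Surjective S := by
    refine hcont.surjective ?_ ?_
    · refine tendsto_atTop_mono' atTop ?_ (tendsto_id.const_mul_atTop hc)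
      filter_upwards [eventually_ge_atTop 0] with w hw
      have := hlow 0 w hw
      rw [hS0] at this
      simpa using this
    · refine tendsto_atBot_mono' atBot ?_ (tendsto_id.const_mul_atBot hc)
      filter_upwards [eventually_le_atBot 0] with w hw
      have := hlow w 0 hw
      rw [hS0] at this
      simp only [id]
      linarith
  let e : ℝ ≃o ℝ := hmono.orderIsoOfSurjective S hsurj
  have he : ∀ w, e w = S w := fun w => rfl
  refine ⟨e.symm, e.symm.continuous, e.symm.strictMono, e.symm.surjective, ?_, fun t ht => ?_⟩
  · rw [OrderIso.symm_apply_eq, he, hS0]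
  · have hd : HasDerivAt S (g (e.symm t)) (e.symm t) :=
      intervalIntegral.integral_hasDerivAt_right (hint _ _)
        (hgm.stronglyMeasurable.stronglyMeasurableAtFilter) (hgc _ ht)
    exact hd.of_local_left_inverse e.symm.continuous.continuousAt
      (hc.trans_le (hg _).1).ne' (Eventually.of_forall fun u => e.apply_symm_apply u)

section Existence

variable {n : ℕ} [NeZero n] {lam s r : ℝ} {P : Matrix (Fin n) (Fin n) ℝ}

theorem relDecay_pos (hL : IsLMISolution n lam P) {z : Fin n → ℝ} (hz : z ≠ 0) :
    0 < relDecay n lam P z :=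
  (decayRate_spec hL).1.trans_le (decayRate_le_relDecay hL hz)

theorem exists_relDecay_le (hL : IsLMISolution n lam P) :
    ∃ C : ℝ, 0 < C ∧ ∀ z : Fin n → ℝ, z ≠ 0 → relDecay n lam P z ≤ C := by
  obtain ⟨c, hc, hcQ⟩ := exists_pos_mul_norm_sq_le hL.2.1
  obtain ⟨C, hC, hCZ⟩ := exists_pos_le_mul_norm_sq (lmiZ n lam P)
  refine ⟨C / c, by positivity, fun z hz => ?_⟩
  have h1 := (abs_le.mp (hCZ z)).1
  have h2 := hcQ z
  have hz' : 0 < ‖z‖ := norm_pos_iff.mpr hz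
  rw [relDecay, div_le_div_iff₀ (quadForm_pos hL.2.1 hz) hc]
  change -(z ⬝ᵥ (lmiZ n lam P *ᵥ z)) * c ≤ C * (z ⬝ᵥ (lmiQ n P *ᵥ z))
  have h3 : -(z ⬝ᵥ (lmiZ n lam P *ᵥ z)) * c ≤ C * ‖z‖ ^ 2 * c :=
    mul_le_mul_of_nonneg_right (by linarith) hc.le
  have h4 := mul_le_mul_of_nonneg_left h2 hC.le
  linarith

/-- The vector field `G_d z + κ(z)⁻¹ (A + B K) z`, which drives the projection of the closed loop
on the ellipsoid when the level is taken as the time. -/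
def sphereField (n : ℕ) [NeZero n] (lam : ℝ) (P : Matrix (Fin n) (Fin n) ℝ) (z : Fin n → ℝ) :
    Fin n → ℝ :=
  dilGen n *ᵥ z + (relDecay n lam P z)⁻¹ • (closedLoopMatrix n lam *ᵥ z)

/-- The vector field `sphereField` is tangent to the ellipsoids `zᵀ P z = const`. -/
theorem sphereField_tangent (hL : IsLMISolution n lam P) {z : Fin n → ℝ} (hz : z ≠ 0) :
    sphereField n lam P z ⬝ᵥ (P *ᵥ z) + z ⬝ᵥ (P *ᵥ sphereField n lam P z) = 0 := by
  have hQ := quadForm_pos hL.2.1 hz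
  have hk := relDecay_pos hL hz
  have a1 := dotProduct_add_dotProduct_eq_quadForm P (dilGen n) z
  have a2 := dotProduct_add_dotProduct_eq_quadForm P (closedLoopMatrix n lam) z
  rw [dilGen_transpose] at a1
  change _ = quadForm (lmiQ n P) z at a1
  change _ = quadForm (lmiZ n lam P) z at a2
  simp only [sphereField, add_dotProduct, mulVec_add, dotProduct_add, smul_dotProduct, mulVec_smul,
    dotProduct_smul, smul_eq_mul]
  have h3 : quadForm (lmiZ n lam P) z = -(relDecay n lam P z * quadForm (lmiQ n P) z) := by
    rw [relDecay]; field_simp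
  have h4 : (relDecay n lam P z)⁻¹ * quadForm (lmiZ n lam P) z = -quadForm (lmiQ n P) z := by
    rw [h3]; field_simp
  linear_combination a1 + (relDecay n lam P z)⁻¹ * a2 + h4

theorem contDiffAt_sphereField (hL : IsLMISolution n lam P) {z : Fin n → ℝ} (hz : z ≠ 0) :
    ContDiffAt ℝ 1 (sphereField n lam P) z := by
  have hlin : ∀ M : Matrix (Fin n) (Fin n) ℝ, ContDiff ℝ 1 fun y : Fin n → ℝ => M *ᵥ y := by
    intro M
    unfold mulVec dotProduct
    fun_prop
  have hk : ContDiffAt ℝ 1 (relDecay n lam P) z :=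
    (contDiff_quadForm _).contDiffAt.neg.div (contDiff_quadForm _).contDiffAt
      (quadForm_pos hL.2.1 hz).ne'
  exact (hlin _).contDiffAt.add ((hk.inv (relDecay_pos hL hz).ne').smul (hlin _).contDiffAt)

/-- The flow on the ellipsoid is complete: cutting the field off away from the ellipsoid makes it
bounded and Lipschitz, and does not change it where the flow takes place. -/
theorem exists_sphere_integralCurve (hL : IsLMISolution n lam P) (hr : 0 < r) (τ₀ : ℝ)
    {z₀ : Fin n → ℝ} (hz₀ : quadForm P z₀ = r ^ 2) :
    ∃ z : ℝ → Fin n → ℝ, z τ₀ = z₀ ∧ ∀ τ, quadForm P (z τ) = r ^ 2 ∧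
      HasDerivAt z (sphereField n lam P (z τ)) τ := by
  have hr2 : 0 < r ^ 2 := by positivity
  let χ : ContDiffBump (r ^ 2) := ⟨r ^ 2 / 4, r ^ 2 / 2, by positivity, by linarith⟩
  let F : (Fin n → ℝ) → (Fin n → ℝ) := fun z => χ (quadForm P z) • sphereField n lam P z
  have hχ : ∀ z, χ (quadForm P z) ≠ 0 → r ^ 2 / 2 < quadForm P z ∧
      quadForm P z < 3 * r ^ 2 / 2 := by
    intro z hz
    have h1 : quadForm P z ∈ Function.support χ := hz
    rw [χ.support_eq, Metric.mem_ball, Real.dist_eq, abs_lt] at h1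
    have h2 : χ.rOut = r ^ 2 / 2 := rfl
    rw [h2] at h1
    constructor <;> linarith [h1.1, h1.2]
  have hFc : ContDiff ℝ 1 F := by
    rw [contDiff_iff_contDiffAt]
    intro z
    rcases eq_or_ne z 0 with rfl | hz
    · refine (contDiffAt_const (c := (0 : Fin n → ℝ))).congr_of_eventuallyEq ?_
      have h0 : quadForm P (0 : Fin n → ℝ) < r ^ 2 / 2 := by rw [quadForm_zero]; positivity
      filter_upwards [(continuous_quadForm P).continuousAt.eventually_lt_const h0] with y hy
      by_contra h
      exact absurd (hχ y fun h' => h (by simp only [F, h', zero_smul])).1 (not_lt.mpr hy.le)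
    · exact ((χ.contDiff.comp (contDiff_quadForm P)).contDiffAt).smul (contDiffAt_sphereField hL hz)
  have hFs : HasCompactSupport F := by
    obtain ⟨c, hc, hcP⟩ := exists_pos_mul_norm_sq_le hL.2.2
    refine HasCompactSupport.of_support_subset_isCompact
      (isCompact_closedBall (0 : Fin n → ℝ) (Real.sqrt (3 * r ^ 2 / 2 / c))) fun z hz => ?_
    have h1 := (hχ z fun h => hz (by simp only [F, h, zero_smul])).2
    rw [mem_closedBall_zero_iff]
    refine Real.le_sqrt_of_sq_le ?_
    rw [le_div_iff₀ hc]
    have h2 : c * ‖z‖ ^ 2 ≤ quadForm P z := hcP z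
    linarith
  obtain ⟨K, hK⟩ := hFc.lipschitzWith_of_hasCompactSupport hFs one_ne_zero
  obtain ⟨C, hC⟩ := hFs.exists_bound_of_continuous hFc.continuous
  obtain ⟨z, hz0, hz⟩ := exists_global_integralCurve (L := C.toNNReal) hK
    (fun x => (hC x).trans (Real.le_coe_toNNReal C)) z₀
  have hconst : ∀ t, HasDerivAt (fun t => quadForm P (z t)) 0 t := by
    intro t
    have h := hasDerivAt_quadForm P (hz t)
    convert! h using 1
    rcases eq_or_ne (z t) 0 with h0 | h0
    · simp [h0]
    · simp only [F, smul_dotProduct, mulVec_smul, dotProduct_smul, ← smul_add,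
        sphereField_tangent hL h0, smul_zero]
  have hq : ∀ t, quadForm P (z t) = r ^ 2 := by
    intro t
    rw [is_const_of_deriv_eq_zero (fun t => (hconst t).differentiableAt)
      (fun t => (hconst t).deriv) t 0, hz0, hz₀]
  refine ⟨fun τ => z (τ - τ₀), by simp only [sub_self, hz0], fun τ => ⟨hq _, ?_⟩⟩
  have h1 := (hz (τ - τ₀)).comp_sub_const τ τ₀
  have h2 : χ (quadForm P (z (τ - τ₀))) = 1 := by
    rw [hq]
    exact χ.one_of_mem_closedBall (Metric.mem_closedBall_self χ.rIn_pos.le)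
  simpa only [F, h2, one_smul] using h1

theorem dilGen_mulVec_dil {n : ℕ} (s : ℝ) (x : Fin n → ℝ) :
    dilGen n *ᵥ (dil n s *ᵥ x) = dil n s *ᵥ (dilGen n *ᵥ x) := by
  ext i
  simp only [dilGen_mulVec_apply, dil_mulVec_apply]
  ring

/-- From a nonzero initial state, the closed loop is solved in closed form from the flow on the
ellipsoid: the gauge `w` is used as a clock running backwards, and the state with gauge `w` is
`d(ln w) z(-ln w)`. -/
theorem exists_solution_of_ne_zero (hL : IsLMISolution n lam P) (hr : 0 < r)
    {x₀ : Fin n → ℝ} (hx₀ : x₀ ≠ 0) :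
    ∃ x : ℝ → Fin n → ℝ, IsFilippovSolution (closedLoop n lam P s r) x ∧ x 0 = x₀ := by
  have ⟨_, hQ, hP⟩ := hL
  obtain ⟨z, hz0, hz⟩ := exists_sphere_integralCurve hL hr (level P r x₀)
    (quadForm_sphereProj hP hQ hr hx₀)
  have hzne : ∀ τ, z τ ≠ 0 := by
    intro τ h
    have := (hz τ).1
    rw [h, quadForm_zero] at this
    have hr2 : 0 < r ^ 2 := by positivity
    linarith
  have hzc : Continuous z := continuous_iff_continuousAt.mpr fun τ => (hz τ).2.continuousAt
  obtain ⟨C, hC, hκC⟩ := exists_relDecay_le hL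
  have hρ := (decayRate_spec hL).1
  let g : ℝ → ℝ := fun w => (relDecay n lam P (z (-Real.log w)))⁻¹
  have hκc : Continuous fun τ => (relDecay n lam P (z τ))⁻¹ :=
    continuous_iff_continuousAt.mpr fun τ =>
      ((continuousAt_relDecay hL (hzne τ)).comp (hz τ).2.continuousAt).inv₀
        (relDecay_pos hL (hzne τ)).ne'
  obtain ⟨h, hhc, hhm, hhs, hh0, hhd⟩ := exists_clock (g := g) (c := C⁻¹)
    (C := (decayRate n lam P)⁻¹) (by positivity)
    (hκc.measurable.comp Real.measurable_log.neg)
    (fun w => ⟨inv_anti₀ (relDecay_pos hL (hzne _)) (hκC _ (hzne _)),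
      inv_anti₀ hρ (decayRate_le_relDecay hL (hzne _))⟩)
    (fun w hw => hκc.continuousAt.comp (Real.continuousAt_log hw).neg)
  let X : ℝ → Fin n → ℝ := fun w => if 0 < w then dil n (Real.log w) *ᵥ z (-Real.log w) else 0
  have hXpos : ∀ {w}, 0 < w → X w = dil n (Real.log w) *ᵥ z (-Real.log w) := fun hw => if_pos hw
  have hXneg : ∀ {w}, w ≤ 0 → X w = 0 := fun hw => if_neg (not_lt.mpr hw)
  have hXne : ∀ {w}, 0 < w → X w ≠ 0 := by
    intro w hw
    rw [hXpos hw, Ne, dil_mulVec_eq_zero_iff]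
    exact hzne _
  have hlevel : ∀ {w}, 0 < w → level P r (X w) = -Real.log w := by
    intro w hw
    refine level_eq_of_quadForm hP hQ hr (hXne hw) ?_
    rw [hXpos hw, dil_mulVec_dil_mulVec, neg_add_cancel, dil_zero, one_mulVec, (hz _).1]
  have hproj : ∀ {w}, 0 < w → sphereProj P r (X w) = z (-Real.log w) := by
    intro w hw
    rw [sphereProj, hlevel hw, hXpos hw, dil_mulVec_dil_mulVec, neg_add_cancel, dil_zero,
      one_mulVec]
  have hloop : ∀ {w}, 0 < w → closedLoop n lam P s r (X w) =
      w⁻¹ • (dil n (Real.log w) *ᵥ (closedLoopMatrix n lam *ᵥ z (-Real.log w))) := by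
    intro w hw
    have h1 := congrArg (fun y => dil n (Real.log w) *ᵥ y)
      (dil_level_mulVec_closedLoop (lam := lam) hP hQ hr s (X w))
    simp only [hlevel hw, hproj hw] at h1
    rwa [dil_mulVec_dil_mulVec, add_neg_cancel, dil_zero, one_mulVec, mulVec_smul, Real.exp_neg,
      Real.exp_log hw] at h1
  have hXd : ∀ {w}, 0 < w → HasDerivAt X (-(g w • closedLoop n lam P s r (X w))) w := by
    intro w hw
    have hlog := Real.hasDerivAt_log hw.ne'
    have hy : HasDerivAt (fun w => z (-Real.log w))
        ((-w⁻¹) • sphereField n lam P (z (-Real.log w))) w :=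
      HasDerivAt.scomp w (hz (-Real.log w)).2 hlog.neg
    have hX := hasDerivAt_dil_mulVec hlog hy
    have hval : w⁻¹ • (dilGen n *ᵥ (dil n (Real.log w) *ᵥ z (-Real.log w))) +
        dil n (Real.log w) *ᵥ ((-w⁻¹) • sphereField n lam P (z (-Real.log w))) =
        -(g w • closedLoop n lam P s r (X w)) := by
      rw [hloop hw, sphereField, dilGen_mulVec_dil]
      simp only [g, mulVec_smul, mulVec_add]
      module
    rw [hval] at hX
    refine hX.congr_of_eventuallyEq ?_
    filter_upwards [eventually_gt_nhds hw] with u hu using hXpos hu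
  have hXc : Continuous X := by
    refine continuous_iff_continuousAt.mpr fun w => ?_
    rcases lt_trichotomy w 0 with hw | rfl | hw
    · refine (continuousAt_const (y := (0 : Fin n → ℝ))).congr ?_
      filter_upwards [eventually_lt_nhds hw] with u hu using (hXneg hu.le).symm
    · obtain ⟨R, hR, hRx⟩ := exists_norm_sphereProj_le hP hQ hr
      rw [ContinuousAt, hXneg le_rfl]
      refine squeeze_zero_norm' (a := fun w => |w| * R) ?_ ?_
      · filter_upwards [eventually_lt_nhds (zero_lt_one : (0 : ℝ) < 1)] with u hu
        rcases le_or_gt u 0 with hu0 | hu0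
        · rw [hXneg hu0, norm_zero]; positivity
        · have h1 := norm_dil_mulVec_le (Real.log_nonpos hu0.le hu.le) (z (-Real.log u))
          rw [Real.exp_log hu0] at h1
          rw [hXpos hu0, abs_of_pos hu0]
          refine h1.trans ?_
          have h2 := hRx (X u)
          rw [hproj hu0] at h2
          gcongr
      · have : Continuous fun w : ℝ => |w| * R := by fun_prop
        simpa using this.tendsto 0
    · exact (hXd hw).continuousAt
  obtain ⟨T, hT⟩ := hhs (Real.exp (-level P r x₀))
  have hmono : ∀ {t u : ℝ}, t ≤ u → h (T - u) ≤ h (T - t) := fun htu =>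
    hhm.monotone (by linarith)
  have hxd : ∀ t, 0 < h (T - t) → HasDerivAt (fun t => X (h (T - t)))
      (closedLoop n lam P s r (X (h (T - t)))) t := by
    intro t ht
    have h1 : HasDerivAt (fun t => h (T - t)) (-(g (h (T - t)))⁻¹) t :=
      (hhd (T - t) ht.ne').comp_const_sub T t
    have h2 := HasDerivAt.scomp t (hXd ht) h1
    have hg : g (h (T - t)) ≠ 0 := (inv_pos.mpr (relDecay_pos hL (hzne _))).ne'
    convert! h2 using 1
    rw [smul_neg, neg_smul, neg_neg, smul_smul, inv_mul_cancel₀ hg, one_smul]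
  have hxc : Continuous fun t => X (h (T - t)) := hXc.comp (hhc.comp (by fun_prop))
  refine ⟨fun t => X (h (T - t)), ⟨fun b hb => ?_, ?_⟩, ?_⟩
  · -- the right derivative is bounded on `[0, b]`, so the curve is Lipschitz there
    obtain ⟨B, hB⟩ := isCompact_Icc.exists_bound_of_continuousOn
      (hxc.continuousOn (s := Set.Icc 0 b))
    obtain ⟨D, hD⟩ := exists_norm_closedLoop_le lam hP hQ hr s B
    let D' : NNReal := ⟨max D 0, le_max_right _ _⟩
    let f' : ℝ → Fin n → ℝ := fun t =>
      if 0 < h (T - t) then closedLoop n lam P s r (X (h (T - t))) else 0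
    have hf' : ∀ t, HasDerivWithinAt (fun t => X (h (T - t))) (f' t) (Set.Ici t) t := by
      intro t
      by_cases ht : 0 < h (T - t)
      · simp only [f', if_pos ht]
        exact (hxd t ht).hasDerivWithinAt
      · simp only [f', if_neg ht]
        refine (hasDerivWithinAt_const t (Set.Ici t) (0 : Fin n → ℝ)).congr (fun u hu => ?_) ?_
        · exact hXneg ((hmono hu).trans (not_lt.mp ht))
        · exact hXneg (not_lt.mp ht)
    have hbound : ∀ t ∈ Set.Icc 0 b, ‖f' t‖ ≤ D' := by
      intro t ht
      simp only [f']
      split_ifs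
      · exact (hD _ (hB t ht)).trans (le_max_left _ _)
      · rw [norm_zero]; exact le_max_right _ _
    refine LipschitzOnWith.absolutelyContinuousOnInterval (K := D') ?_
    rw [Set.uIcc_of_le hb]
    have hlip : ∀ u ∈ Set.Icc 0 b, ∀ v ∈ Set.Icc 0 b, u ≤ v →
        dist (X (h (T - v))) (X (h (T - u))) ≤ D' * dist v u := by
      intro u hu v hv huv
      rw [dist_eq_norm, Real.dist_eq, abs_of_nonneg (sub_nonneg.mpr huv)]
      exact norm_image_sub_le_of_norm_deriv_right_le_segment hxc.continuousOn (fun t _ => hf' t)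
        (fun t ht => hbound t ⟨hu.1.trans ht.1, ht.2.le.trans hv.2⟩) v ⟨huv, le_rfl⟩
    refine LipschitzOnWith.of_dist_le_mul fun u hu v hv => ?_
    rcases le_total u v with huv | huv
    · rw [dist_comm, dist_comm u]
      exact hlip u hu v hv huv
    · exact hlip v hv u hu huv
  · have hae : ∀ᵐ t : ℝ, t ≠ T := by simp [ae_iff, measure_singleton]
    filter_upwards [hae] with t htT _
    rcases lt_trichotomy (h (T - t)) 0 with ht | ht | ht
    · refine ⟨0, ?_, ?_⟩
      · rw [hXneg ht.le]
        exact zero_mem_filippovMap_of_odd (closedLoop_neg hP hQ hr s)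
      · refine (hasDerivAt_const t (0 : Fin n → ℝ)).congr_of_eventuallyEq ?_
        have hc : Continuous fun t => h (T - t) := hhc.comp (by fun_prop)
        filter_upwards [hc.continuousAt.eventually_lt_const ht] with u hu using hXneg hu.le
    · exact absurd (hhm.injective (ht.trans hh0.symm)) (sub_ne_zero.mpr htT.symm)
    · exact ⟨_, apply_mem_filippovMap (continuousAt_closedLoop hP hQ hr s (hXne ht)), hxd t ht⟩
  · simp only [sub_zero]
    rw [hT, hXpos (Real.exp_pos _), Real.log_exp, neg_neg, hz0, dil_neg_level_sphereProj]

theorem hasGlobalSolutions_closedLoop (hL : IsLMISolution n lam P) (hr : 0 < r) :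
    HasGlobalSolutions (closedLoop n lam P s r) := by
  intro x₀
  rcases eq_or_ne x₀ 0 with rfl | hx₀
  · refine ⟨fun _ => 0, ⟨fun b _ => ?_, ?_⟩, rfl⟩
    · exact ((LipschitzWith.const (0 : Fin n → ℝ)).lipschitzOnWith).absolutelyContinuousOnInterval
    · exact Eventually.of_forall fun t _ => ⟨0,
        zero_mem_filippovMap_of_odd (closedLoop_neg hL.2.2 hL.2.1 hr s), hasDerivAt_const t _⟩
  · exact exists_solution_of_ne_zero hL hr hx₀

end Existence

end HomControl

end

theorem theorem1 (n : ℕ) [NeZero n] (lam : ℝ) (hlam : 0 < lam) :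
    -- feasibility of the linear matrix inequalities
    (∃ P : Matrix (Fin n) (Fin n) ℝ, HomControl.IsLMISolution n lam P) ∧
    ∀ P : Matrix (Fin n) (Fin n) ℝ, HomControl.IsLMISolution n lam P →
      0 < HomControl.decayRate n lam P ∧
      ∀ T s r : ℝ, 0 < T → 0 < r →
        Real.log (max (1 / (HomControl.decayRate n lam P * T)) 1) ≤ s →
        -- the homogeneous norm is well defined
        (∀ x : Fin n → ℝ, x ≠ 0 → ∃! σ : ℝ,
          HomControl.weightedNorm (HomControl.scaledWeight P s)
            (Matrix.mulVec (HomControl.dil n (-σ)) x) = 1) ∧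
        -- finite-time stabilization, with settling time at most `T` on the ball of radius `r`
        HomControl.HasGlobalSolutions (HomControl.closedLoop n lam P s r) ∧
        HomControl.IsFiniteTimeStable (HomControl.closedLoop n lam P s r) ∧
        (∀ x : ℝ → Fin n → ℝ,
          HomControl.IsFilippovSolution (HomControl.closedLoop n lam P s r) x →
          HomControl.weightedNorm (HomControl.scaledWeight P s) (x 0) ≤ r →
          ∀ t : ℝ, T ≤ t → x t = 0) ∧
        -- the homogeneous cone
        HomControl.IsPositivelyInvariant (HomControl.closedLoop n lam P s r)
          (HomControl.homCone n lam P s r) ∧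
        HomControl.homCone n lam P s r ⊆ HomControl.safeHalfSpace n ∧
        HomControl.linCone n lam ⊆ HomControl.safeHalfSpace n ∧
        ∀ x₀ : Fin n → ℝ, x₀ ∈ HomControl.linCone n lam →
          HomControl.homNorm (HomControl.scaledWeight P s) (r⁻¹ • x₀) ≤ Real.exp s →
          x₀ ∈ HomControl.homCone n lam P s r := by
  refine ⟨HomControl.exists_isLMISolution n hlam, fun P hL =>
    ⟨(HomControl.decayRate_spec hL).1, fun T s r hT hr hs => ⟨fun x hx => ?_,
      HomControl.hasGlobalSolutions_closedLoop hL hr,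
      HomControl.isFiniteTimeStable_closedLoop hL hr,
      fun x hx hx0 t ht => HomControl.eq_zero_of_weightedNorm_le hL hr hT hs hx hx0 ht,
      HomControl.isPositivelyInvariant_homCone hlam hL hr, HomControl.homCone_subset hL hr,
      HomControl.linCone_subset,
      fun x₀ hx₀ hle => HomControl.mem_homCone_of_mem_linCone hlam hL hr hx₀ hle⟩⟩⟩
  obtain ⟨τ, hτ, huniq⟩ := HomControl.existsUnique_level hL.2.2 hL.2.1 one_pos hx
  have key : ∀ σ : ℝ, HomControl.weightedNorm (HomControl.scaledWeight P s)
      (Matrix.mulVec (HomControl.dil n (-σ)) x) = 1 ↔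
      HomControl.quadForm P (Matrix.mulVec (HomControl.dil n (s - σ)) x) = 1 ^ 2 := by
    intro σ
    have := HomControl.weightedNorm_scaledWeight_eq_one_iff (P := P) (one_pos : (0 : ℝ) < 1) s σ x
    rwa [inv_one, one_smul] at this
  refine ⟨s - τ, (key _).mpr (by rw [sub_sub_cancel]; exact hτ), fun σ hσ => ?_⟩
  have := huniq _ ((key σ).mp hσ)
  linarith
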